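/- Consider a system of $k\ge 1$ identical servers, each of which works at rate $1$. Elastic jobs arrive according to a Poisson process of rate $\lambda_E>0$ and have independent sizes distributed as $\mathrm{Exp}(\mu_E)$; inelastic jobs arrive according to an independent Poisson process of rate $\lambda_I>0$ and have independent sizes distributed as $\mathrm{Exp}(\mu_I)$, where $\mu_E,\mu_I>0$. A job that holds $a$ servers ($a\in\mathbb{R}_{\ge 0}$, fractions allowed) is processed at rate $a$. An inelastic job can hold at most one server, an elastic job can hold any number of servers. Assume that the load satisfies $$\rho=\frac{\lambda_I}{k\mu_I}+\frac{\lambda_E}{k\mu_E}<1 .$$ A (stationary, deterministic) policy $\pi$ assigns to each state $(i,j)$ ($i$ inelastic and $j$ elastic jobs in the system) an allocation of servers to the $i+j$ jobs, the jobs of each class being distinguished by their order of arrival, with at most one server for each inelastic job and at most $k$ servers in total. Let $\pi_I(i,j)$ and $\pi_E(i,j)$ be the total numbers of servers given to inelastic and to elastic jobs. Under $\pi$, the numbers $(N_I(t),N_E(t))$ of inelastic and elastic jobs in the system form a continuous-time Markov chain. Let $T^\pi$ be the response time (the time from arrival to completion) of a job that arrives when the system is in steady state, that is, when $(N_I,N_E)$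 follows the stationary distribution of this chain; put $\mathbb{E}[T^\pi]=\infty$ if there is no stationary distribution. Optimal means that $\mathbb{E}[T^\pi]$ is minimal among all such policies. The policy $\pi$ unnecessarily idles servers if in some state $(i,j)$ fewer than $k$ servers are in use although there is an elastic job or an inelastic job that holds less than one server; otherwise it is non-idling. Equivalently, $\pi$ is non-idling if and only if it is work-conserving: $\pi_I(i,j)+\pi_E(i,j)\ge\min(i,k)$ for all $(i,j)$, and $\pi_I(i,j)+\pi_E(i,j)=k$ whenever $j>0$. Then for every policy $\pi$ that unnecessarily idles servers there is a non-idling policy $\pi'$ with $\mathbb{E}[T^{\pi'}]\le\mathbb{E}[T^\pi]$. Moreover, there is an optimal policy that is work-conserving. -/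

import Mathlib

open MeasureTheory ProbabilityTheory
open scoped NNReal ENNReal

noncomputable section

/-! ### Continuous-time Markov chains with finitely many transitions out of each state -/

namespace CTMC

/-- Transition rates on `S`: for every state, the finite list of its outgoing transitions, each
given by its rate and its target. Entries with the same target add up. -/
abbrev Rates (S : Type) : Type := S → List (ℝ≥0 × S)

variable {S : Type}

/-- The total rate of the transitions out of `x`. -/
def exitRate (Q : Rates S) (x : S) : ℝ≥0 := ((Q x).map Prod.fst).sum

open scoped Classical in
/-- The total rate of the transitions from `x` to `y`. -/
def rate (Q : Rates S) (x y : S) : ℝ≥0 := ((Q x).map fun t => if t.2 = y then t.1 else 0).sum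

/-- `ν` is a stationary distribution of the chain: the flow into each state `y` equals the
flow out of it. -/
def IsStationary (Q : Rates S) (ν : PMF S) : Prop :=
  ∀ y, ∑' x, ν x * (rate Q x y : ℝ≥0∞) = ν y * (exitRate Q y : ℝ≥0∞)

variable [MeasurableSpace S]

open scoped Classical in
/-- The law of the next state of the jump chain, from `x`: each transition is taken with
probability proportional to its rate; a state without outgoing rate is absorbing. -/
def jumpMeasure (Q : Rates S) (x : S) : Measure S :=
  if exitRate Q x = 0 then Measure.dirac x
  else ((exitRate Q x : ℝ≥0∞))⁻¹ •
    ((Q x).map fun t => (t.1 : ℝ≥0∞) • Measure.dirac t.2).sum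

theorem list_sum_smul_dirac_univ (l : List (ℝ≥0 × S)) :
    ((l.map fun t => (t.1 : ℝ≥0∞) • Measure.dirac t.2).sum : Measure S) Set.univ
      = (((l.map Prod.fst).sum : ℝ≥0) : ℝ≥0∞) := by
  induction l with
  | nil => simp
  | cons a l ih =>
    rw [List.map_cons, List.sum_cons, Measure.add_apply, ih]
    simp

theorem isProbabilityMeasure_jumpMeasure (Q : Rates S) (x : S) :
    IsProbabilityMeasure (jumpMeasure Q x) := by
  unfold jumpMeasure
  split_ifs with h
  · infer_instance
  · constructor
    rw [Measure.smul_apply, list_sum_smul_dirac_univ, smul_eq_mul]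
    exact ENNReal.inv_mul_cancel (by exact_mod_cast h) ENNReal.coe_ne_top

variable [Countable S] [DiscreteMeasurableSpace S]

/-- The transition kernel of the jump chain. -/
def jumpKernel (Q : Rates S) : Kernel S S := Kernel.ofFunOfCountable (jumpMeasure Q)

instance (Q : Rates S) : IsMarkovKernel (jumpKernel Q) :=
  ⟨fun x => isProbabilityMeasure_jumpMeasure Q x⟩

/-- The law on `ℕ → S` of the jump chain with initial distribution `μ₀`. -/
def jumpChain (Q : Rates S) (μ₀ : Measure S) : Measure (ℕ → S) :=
  Kernel.trajMeasure (X := fun _ => S) μ₀ fun n =>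
    (jumpKernel Q).comap (fun h : (i : Finset.Iic n) → S => h ⟨n, Finset.mem_Iic.2 le_rfl⟩)
      (measurable_pi_apply _)

instance : IsProbabilityMeasure (expMeasure 1) := isProbabilityMeasure_expMeasure one_pos

/-- The law of the continuous-time chain, as the pair of its jump chain `Y` and an independent
sequence `e` of independent exponential variables of rate `1`. The chain visits `Y 0, Y 1, …`
in this order and stays in `Y n` for the time `e n / exitRate Q (Y n)`. -/
def pathMeasure (Q : Rates S) (μ₀ : Measure S) : Measure ((ℕ → S) × (ℕ → ℝ)) :=
  (jumpChain Q μ₀).prod (Measure.infinitePi fun _ : ℕ => expMeasure 1)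

open scoped Classical in
/-- The total time that the chain spends outside of the state `a`. If `a` is absorbing, this is
the time at which the chain reaches `a` (infinite if it never does). -/
def absorptionTime (Q : Rates S) (a : S) (ω : (ℕ → S) × (ℕ → ℝ)) : ℝ≥0∞ :=
  ∑' n, if ω.1 n = a then 0 else ENNReal.ofReal (ω.2 n) / (exitRate Q (ω.1 n) : ℝ≥0∞)

end CTMC

/-! ### The queueing system -/

namespace ElasticQueue

/-- The parameters of the system: the number `k` of servers, the arrival rates and the size
rates of inelastic (`I`) and elastic (`E`) jobs. -/
structure Model where
  k : ℕ
  lamI : ℝ≥0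
  lamE : ℝ≥0
  muI : ℝ≥0
  muE : ℝ≥0
  k_pos : 0 < k
  lamI_pos : 0 < lamI
  lamE_pos : 0 < lamE
  muI_pos : 0 < muI
  muE_pos : 0 < muE

/-- The system load. -/
def Model.load (M : Model) : ℝ≥0 := M.lamI / (M.k * M.muI) + M.lamE / (M.k * M.muE)

/-- A stationary deterministic allocation policy. In state `(i, j)`, that is, with `i` inelastic
and `j` elastic jobs in the system, `allocI i j p` is the number of servers given to the
inelastic job with exactly `p` older inelastic jobs (`p < i`), and `allocE i j p` the number
given to the elastic job with exactly `p` older elastic jobs (`p < j`). Values at other `p`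
are irrelevant. -/
structure Policy (k : ℕ) where
  allocI : ℕ → ℕ → ℕ → ℝ≥0
  allocE : ℕ → ℕ → ℕ → ℝ≥0
  allocI_le_one : ∀ i j p, p < i → allocI i j p ≤ 1
  total_le : ∀ i j,
    ∑ p ∈ Finset.range i, allocI i j p + ∑ p ∈ Finset.range j, allocE i j p ≤ k

namespace Policy

variable {k : ℕ}

/-- The number of servers allocated to inelastic jobs in state `(i, j)`. -/
def serversI (π : Policy k) (i j : ℕ) : ℝ≥0 := ∑ p ∈ Finset.range i, π.allocI i j p

/-- The number of servers allocated to elastic jobs in state `(i, j)`. -/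
def serversE (π : Policy k) (i j : ℕ) : ℝ≥0 := ∑ p ∈ Finset.range j, π.allocE i j p

/-- In some state, server capacity is left idle although some job could use more of it:
either any elastic job, or an inelastic job that has less than one server. -/
def IdlesUnnecessarily (π : Policy k) : Prop :=
  ∃ i j, π.serversI i j + π.serversE i j < k ∧ (0 < j ∨ ∃ p < i, π.allocI i j p < 1)

/-- All `k` servers are in use whenever there is an elastic job, and at least `min i k` servers
are in use in every state. -/
def WorkConserving (π : Policy k) : Prop :=
  ∀ i j : ℕ, min (i : ℝ≥0) k ≤ π.serversI i j + π.serversE i j ∧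
    (0 < j → π.serversI i j + π.serversE i j = k)

theorem workConserving_iff (π : Policy k) : π.WorkConserving ↔ ¬ π.IdlesUnnecessarily := by
  constructor
  · rintro h ⟨i, j, hlt, hj | ⟨p, hp, hp1⟩⟩
    · exact hlt.ne ((h i j).2 hj)
    · rcases Nat.eq_zero_or_pos j with rfl | hj
      · have h1 := (h i 0).1
        have hI : π.serversI i 0 < i := by
          have := Finset.sum_lt_sum (s := Finset.range i) (f := π.allocI i 0) (g := fun _ => 1)
            (fun q hq => π.allocI_le_one i 0 q (Finset.mem_range.1 hq))
            ⟨p, Finset.mem_range.2 hp, hp1⟩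
          simpa [serversI] using this
        have hE : π.serversE i 0 = 0 := by simp [serversE]
        rw [hE, add_zero] at h1 hlt
        exact absurd h1 (not_le.2 (lt_min hI hlt))
      · exact hlt.ne ((h i j).2 hj)
  · intro h i j
    have hle : π.serversI i j + π.serversE i j ≤ k := π.total_le i j
    rcases hle.lt_or_eq with hlt | heq
    · have hn : ¬ (0 < j ∨ ∃ p < i, π.allocI i j p < 1) := fun hc => h ⟨i, j, hlt, hc⟩
      push Not at hn
      refine ⟨(min_le_left _ _).trans ?_, fun hj => absurd hj (not_lt.2 hn.1)⟩
      have := Finset.sum_le_sum (s := Finset.range i) (f := fun _ => (1 : ℝ≥0))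
        (g := π.allocI i j) (fun q hq => hn.2 q (Finset.mem_range.1 hq))
      exact le_add_right (by simpa [serversI] using this)
    · exact ⟨heq ▸ min_le_right _ _, fun _ => heq⟩

end Policy

/-- The chain `(N_I(t), N_E(t))` of the numbers of inelastic and elastic jobs under `π`. (The
truncated `i - 1` and `j - 1` at `0` only occur with rate `0`.) -/
def countRates (M : Model) (π : Policy M.k) : CTMC.Rates (ℕ × ℕ) := fun s =>
  [(M.lamI, (s.1 + 1, s.2)),
   (M.lamE, (s.1, s.2 + 1)),
   (M.muI * π.serversI s.1 s.2, (s.1 - 1, s.2)),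
   (M.muE * π.serversE s.1 s.2, (s.1, s.2 - 1))]

/-- The state of the system as seen from a tagged job. -/
inductive Tagged where
  /-- The tagged job is inelastic; there are `older` inelastic jobs older than it, `younger`
  inelastic jobs younger than it, and `j` elastic jobs. -/
  | inelastic (older younger j : ℕ)
  /-- The tagged job is elastic; there are `i` inelastic jobs, `older` elastic jobs older than
  it, and `younger` elastic jobs younger than it. -/
  | elastic (i older younger : ℕ)
  /-- The tagged job is completed. -/
  | done

namespace Tagged

instance : MeasurableSpace Tagged := ⊤

instance : DiscreteMeasurableSpace Tagged := ⟨fun _ => trivial⟩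

instance : Countable Tagged := by
  let f : Tagged → Option (Bool × ℕ × ℕ × ℕ) := fun x =>
    match x with
    | inelastic a b c => some (true, a, b, c)
    | elastic a b c => some (false, a, b, c)
    | done => none
  refine Function.Injective.countable (f := f) ?_
  intro x y h
  cases x <;> cases y <;> simp_all [f]

end Tagged

/-- The chain followed by the system as seen from a tagged job. Each job in the system has an
exponential remaining size, so that it completes at the rate `muI` (or `muE`) times the number
of servers that it holds; the listed transitions are, in this order: an inelastic arrival, an
elastic arrival, the completion of an older job of the class of the tagged job, of a younger
one, of the tagged job, and of a job of the other class. -/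
def taggedRates (M : Model) (π : Policy M.k) : CTMC.Rates Tagged
  | .inelastic a b j =>
    let i := a + 1 + b
    [(M.lamI, .inelastic a (b + 1) j),
     (M.lamE, .inelastic a b (j + 1)),
     (M.muI * ∑ p ∈ Finset.range a, π.allocI i j p, .inelastic (a - 1) b j),
     (M.muI * ∑ p ∈ Finset.Ico (a + 1) i, π.allocI i j p, .inelastic a (b - 1) j),
     (M.muI * π.allocI i j a, .done),
     (M.muE * π.serversE i j, .inelastic a b (j - 1))]
  | .elastic i a b =>
    let j := a + 1 + b
    [(M.lamI, .elastic (i + 1) a b),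
     (M.lamE, .elastic i a (b + 1)),
     (M.muE * ∑ p ∈ Finset.range a, π.allocE i j p, .elastic i (a - 1) b),
     (M.muE * ∑ p ∈ Finset.Ico (a + 1) j, π.allocE i j p, .elastic i a (b - 1)),
     (M.muE * π.allocE i j a, .done),
     (M.muI * π.serversI i j, .elastic (i - 1) a b)]
  | .done => []

/-- The state just after the arrival of a job that finds the system distributed as `ν`. The job
is inelastic with probability `lamI / (lamI + lamE)` and elastic otherwise, and it is the
youngest job of its class. -/
def arrivalLaw (M : Model) (ν : PMF (ℕ × ℕ)) : Measure Tagged :=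
  ν.toMeasure.bind fun s =>
    ((M.lamI / (M.lamI + M.lamE) : ℝ≥0) : ℝ≥0∞) • Measure.dirac (Tagged.inelastic s.1 0 s.2) +
    ((M.lamE / (M.lamI + M.lamE) : ℝ≥0) : ℝ≥0∞) • Measure.dirac (Tagged.elastic s.1 s.2 0)

/-- The response time of the tagged job: the time from its arrival until its completion. -/
def responseTime (M : Model) (π : Policy M.k) (ω : (ℕ → Tagged) × (ℕ → ℝ)) : ℝ≥0∞ :=
  CTMC.absorptionTime (taggedRates M π) .done ω

/-- The mean response time `E[T]` of a job that arrives when the system is in steady state, that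
is, distributed as a stationary distribution of `(N_I, N_E)`. From any two states the chain
reaches a common one through arrivals, so that it has at most one stationary distribution and
the infimum runs over at most one element; it is `∞` if there is no steady state. -/
def meanResponseTime (M : Model) (π : Policy M.k) : ℝ≥0∞ :=
  ⨅ (ν : PMF (ℕ × ℕ)) (_ : CTMC.IsStationary (countRates M π) ν),
    ∫⁻ ω, responseTime M π ω ∂(CTMC.pathMeasure (taggedRates M π) (arrivalLaw M ν))

end ElasticQueue

end

/-!
The proof compares an arbitrary policy `π` that has a stationary distribution with work-conserving
systems, and finds an optimal work-conserving policy as a limit of such systems.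

*Little's law, one direction.* For a stationary distribution `ν` of the numbers of jobs, the mean
number of jobs under `ν` is at least `lamI + lamE` times the mean response time
(`lam_mul_lintegral_responseTime_le`). The reason is that the generator of the system acts on a
sum over all jobs in the system through the generator seen from each single job, plus a
contribution of the arriving jobs (`jobSum_flow`). Equality can fail, because jobs that stay in the
system forever do not contribute to the response times of arriving jobs. The other direction
therefore has to ignore such jobs.

*Coupling.* Start the system under `π` in its stationary distribution, and call the jobs that are
there at time `0` old. Run it together with a second system that is empty at time `0`, sees the
same arrivals, and is work-conserving: it gives to its inelastic jobs as many servers as `π` gives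
to the new ones (as far as they can use them), and all others to its elastic jobs. Whenever the
numbers of new jobs of a class agree with those of the second system, the latter serves this class
at least as fast (`newI_le_wcI`, `newE_le_wcE`), so it never has more jobs of a class than `π` has
new jobs. The mean number of new jobs, averaged over time, is at most `lamI + lamE` times
the mean response time (`sum_coupledMean_card_le`), again by `jobSum_flow`.

*Compactness.* The averages over time of the coupled work-conserving system are allocations, that
is, distributions on the states with mean numbers of allocated servers, which satisfy the balance
equations up to an error that vanishes with time (`exists_isAllocation_nearly_balanced`). Along a
sequence of policies whose mean response times tend to the infimum, the mean numbers of jobs stay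
bounded, so the allocations are tight and have a limit, which is in balance and still
work-conserving (`exists_balanced_isAllocation`). As fractions of servers can be allocated, the
limit is the stationary regime of a deterministic work-conserving policy
(`exists_workConserving_isStationary`). By the first step, its mean response time is at most the
infimum.
-/

/-! ### Jump chains, expected absorption times and stationary distributions -/

namespace CTMC

variable {S : Type}

/-- The off-diagonal part of the generator of the chain, acting on functions: the expected rate
at which the chain in state `x` collects the reward `f y` for a transition to `y`. -/
noncomputable def flow (Q : Rates S) (f : S → ℝ≥0∞) (x : S) : ℝ≥0∞ :=
  ((Q x).map fun t => (t.1 : ℝ≥0∞) * f t.2).sum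

theorem tsum_rate_mul (Q : Rates S) (f : S → ℝ≥0∞) (x : S) :
    ∑' y, (rate Q x y : ℝ≥0∞) * f y = flow Q f x := by
  classical
  unfold rate flow
  induction Q x with
  | nil => simp
  | cons a l ih =>
    simp only [List.map_cons, List.sum_cons, ENNReal.coe_add, add_mul]
    rw [ENNReal.tsum_add, ih, tsum_eq_single a.2]
    · simp
    · intro y hy
      simp [Ne.symm hy]

theorem IsStationary.tsum_flow {Q : Rates S} {ν : PMF S} (h : IsStationary Q ν)
    (f : S → ℝ≥0∞) :
    ∑' x, ν x * flow Q f x = ∑' x, ν x * (exitRate Q x * f x) := by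
  simp_rw [← tsum_rate_mul, ← ENNReal.tsum_mul_left]
  rw [ENNReal.tsum_comm]
  refine tsum_congr fun y => ?_
  simp_rw [← mul_assoc]
  rw [ENNReal.tsum_mul_right, h y]

open scoped Classical in
/-- The mean time that the chain spends in its current state `x`, counted as `0` in the state
`a`. -/
noncomputable def meanHoldingTime (Q : Rates S) (a x : S) : ℝ≥0∞ :=
  if x = a then 0 else (exitRate Q x : ℝ≥0∞)⁻¹

theorem exitRate_mul_meanHoldingTime {Q : Rates S} {a x : S} (hxa : x ≠ a)
    (hx : exitRate Q x ≠ 0) : exitRate Q x * meanHoldingTime Q a x = 1 := by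
  rw [meanHoldingTime, if_neg hxa,
    ENNReal.mul_inv_cancel (by exact_mod_cast hx) ENNReal.coe_ne_top]

variable [MeasurableSpace S]

/-- The expectation of `f` at the next state of the jump chain from `x`. -/
noncomputable def jumpStep (Q : Rates S) (f : S → ℝ≥0∞) (x : S) : ℝ≥0∞ := ∫⁻ y, f y ∂jumpMeasure Q x

/-- The expected time spent outside of `a` during the first `n` stays in a state. -/
noncomputable def meanTimeUpTo (Q : Rates S) (a : S) : ℕ → S → ℝ≥0∞
  | 0, _ => 0
  | n + 1, x => meanHoldingTime Q a x + jumpStep Q (meanTimeUpTo Q a n) x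

/-- The expected total time spent outside of `a`, as a function of the initial state. -/
noncomputable def meanTime (Q : Rates S) (a x : S) : ℝ≥0∞ :=
  ∑' n, (jumpStep Q)^[n] (meanHoldingTime Q a) x

/-- If all exit rates off `a` are at least `c`, then each stay lasts at most `1 / c` on
average. -/
theorem meanTimeUpTo_le {Q : Rates S} {a : S} {c : ℝ≥0∞}
    (hc : ∀ x, x ≠ a → c ≤ exitRate Q x) (n : ℕ) (x : S) : meanTimeUpTo Q a n x ≤ n * c⁻¹ := by
  induction n generalizing x with
  | zero => simp [meanTimeUpTo]
  | succ n ih =>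
    have h1 : meanHoldingTime Q a x ≤ c⁻¹ := by
      unfold meanHoldingTime
      split_ifs with hx
      · exact zero_le
      · exact ENNReal.inv_le_inv.2 (hc x hx)
    have h2 : jumpStep Q (meanTimeUpTo Q a n) x ≤ n * c⁻¹ := by
      have := isProbabilityMeasure_jumpMeasure Q x
      calc jumpStep Q (meanTimeUpTo Q a n) x ≤ ∫⁻ _, n * c⁻¹ ∂jumpMeasure Q x :=
            lintegral_mono fun y => ih y
        _ = n * c⁻¹ := by simp
    rw [meanTimeUpTo, Nat.cast_succ, add_mul, one_mul, add_comm]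
    exact add_le_add h2 h1

variable [DiscreteMeasurableSpace S]

theorem lintegral_list_sum_smul_dirac (l : List (ℝ≥0 × S)) (f : S → ℝ≥0∞) :
    ∫⁻ y, f y ∂((l.map fun t => (t.1 : ℝ≥0∞) • Measure.dirac t.2).sum : Measure S)
      = (l.map fun t => (t.1 : ℝ≥0∞) * f t.2).sum := by
  induction l with
  | nil => simp
  | cons a l ih =>
    rw [List.map_cons, List.sum_cons, lintegral_add_measure, ih, lintegral_smul_measure,
      lintegral_dirac]
    simp

theorem exitRate_mul_jumpStep {Q : Rates S} {x : S} (hx : exitRate Q x ≠ 0) (f : S → ℝ≥0∞) :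
    exitRate Q x * jumpStep Q f x = flow Q f x := by
  rw [jumpStep, jumpMeasure, if_neg hx, lintegral_smul_measure, lintegral_list_sum_smul_dirac,
    smul_eq_mul, ← mul_assoc, ENNReal.mul_inv_cancel (by exact_mod_cast hx) ENNReal.coe_ne_top,
    one_mul, flow]

theorem jumpStep_of_exitRate_eq_zero {Q : Rates S} {x : S} (hx : exitRate Q x = 0)
    (f : S → ℝ≥0∞) : jumpStep Q f x = f x := by
  rw [jumpStep, jumpMeasure, if_pos hx, lintegral_dirac]

theorem jumpStep_tsum (Q : Rates S) (f : ℕ → S → ℝ≥0∞) (x : S) :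
    jumpStep Q (fun y => ∑' n, f n y) x = ∑' n, jumpStep Q (f n) x :=
  lintegral_tsum fun _ => Measurable.of_discrete.aemeasurable

theorem meanTimeUpTo_eq_sum (Q : Rates S) (a : S) (n : ℕ) :
    meanTimeUpTo Q a n =
      fun x => ∑ m ∈ Finset.range n, (jumpStep Q)^[m] (meanHoldingTime Q a) x := by
  induction n with
  | zero => funext x; simp [meanTimeUpTo]
  | succ n ih =>
    funext x
    rw [meanTimeUpTo, ih, Finset.sum_range_succ', add_comm]
    simp only [Function.iterate_succ_apply', Function.iterate_zero, id]
    congr 1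
    exact lintegral_finsetSum _ fun _ _ => Measurable.of_discrete

theorem meanTimeUpTo_mono (Q : Rates S) (a : S) : Monotone (meanTimeUpTo Q a) := by
  refine monotone_nat_of_le_succ fun n x => ?_
  simp only [meanTimeUpTo_eq_sum, Finset.sum_range_succ]
  exact le_self_add

theorem meanTime_eq_iSup (Q : Rates S) (a x : S) :
    meanTime Q a x = ⨆ n, meanTimeUpTo Q a n x := by
  simp_rw [meanTimeUpTo_eq_sum]
  exact ENNReal.tsum_eq_iSup_nat

theorem jumpStep_iterate_meanHoldingTime_self {Q : Rates S} {a : S} (ha : exitRate Q a = 0)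
    (n : ℕ) : (jumpStep Q)^[n] (meanHoldingTime Q a) a = 0 := by
  induction n with
  | zero => simp [meanHoldingTime]
  | succ n ih => rw [Function.iterate_succ_apply', jumpStep_of_exitRate_eq_zero ha, ih]

theorem meanTime_self {Q : Rates S} {a : S} (ha : exitRate Q a = 0) : meanTime Q a a = 0 := by
  simp [meanTime, jumpStep_iterate_meanHoldingTime_self ha]

theorem meanTimeUpTo_self {Q : Rates S} {a : S} (ha : exitRate Q a = 0) (n : ℕ) :
    meanTimeUpTo Q a n a = 0 := by
  simp [meanTimeUpTo_eq_sum, jumpStep_iterate_meanHoldingTime_self ha]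

/-- First-step analysis of `meanTimeUpTo`. -/
theorem exitRate_mul_meanTimeUpTo_succ {Q : Rates S} {a x : S} (hxa : x ≠ a)
    (hx : exitRate Q x ≠ 0) (n : ℕ) :
    exitRate Q x * meanTimeUpTo Q a (n + 1) x = 1 + flow Q (meanTimeUpTo Q a n) x := by
  rw [meanTimeUpTo, mul_add, exitRate_mul_meanHoldingTime hxa hx, exitRate_mul_jumpStep hx]

/-- First-step analysis of `meanTime`. -/
theorem exitRate_mul_meanTime {Q : Rates S} {a x : S} (hxa : x ≠ a) (hx : exitRate Q x ≠ 0) :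
    exitRate Q x * meanTime Q a x = 1 + flow Q (meanTime Q a) x := by
  rw [← exitRate_mul_jumpStep hx, ← exitRate_mul_meanHoldingTime hxa hx, ← mul_add]
  congr 1
  change _ = _ + jumpStep Q (fun y => ∑' n, (jumpStep Q)^[n] (meanHoldingTime Q a) y) x
  rw [jumpStep_tsum, meanTime, tsum_eq_zero_add' ENNReal.summable]
  simp only [Function.iterate_succ_apply', Function.iterate_zero, id]

variable [Countable S]

theorem lintegral_jumpChain_succ (Q : Rates S) (μ₀ : Measure S) [IsProbabilityMeasure μ₀]
    (n : ℕ) (f : S → ℝ≥0∞) :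
    ∫⁻ Y, f (Y (n + 1)) ∂jumpChain Q μ₀ = ∫⁻ Y, jumpStep Q f (Y n) ∂jumpChain Q μ₀ := by
  set κ : (n : ℕ) → Kernel ((i : Finset.Iic n) → S) S := fun n =>
    (jumpKernel Q).comap (fun h : (i : Finset.Iic n) → S => h ⟨n, Finset.mem_Iic.2 le_rfl⟩)
      (measurable_pi_apply _) with hκ
  have key := Kernel.map_frestrictLe_trajMeasure_compProd_eq_map_trajMeasure
    (X := fun _ => S) (μ₀ := μ₀) (κ := κ) (a := n)
  have hf : Measurable f := Measurable.of_discrete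
  have h1 : ∫⁻ Y, f (Y (n + 1)) ∂jumpChain Q μ₀
      = ∫⁻ p, f p.2 ∂((Kernel.trajMeasure (X := fun _ => S) μ₀ κ).map
        (fun x => (Preorder.frestrictLe (π := fun _ => S) n x, x (n + 1)))) := by
    rw [lintegral_map (by fun_prop) (by fun_prop)]
    rfl
  rw [h1, ← key, Measure.lintegral_compProd (by fun_prop), lintegral_map _ (by fun_prop)]
  · rfl
  · exact Measurable.lintegral_kernel_prod_right' (f := fun p : _ × S => f p.2) (by fun_prop)

theorem lintegral_jumpChain_zero (Q : Rates S) (μ₀ : Measure S) [IsProbabilityMeasure μ₀]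
    (f : S → ℝ≥0∞) : ∫⁻ Y, f (Y 0) ∂jumpChain Q μ₀ = ∫⁻ x, f x ∂μ₀ := by
  set κ : (n : ℕ) → Kernel ((i : Finset.Iic n) → S) S := fun n =>
    (jumpKernel Q).comap (fun h : (i : Finset.Iic n) → S => h ⟨n, Finset.mem_Iic.2 le_rfl⟩)
      (measurable_pi_apply _) with hκ
  have hf : Measurable f := Measurable.of_discrete
  have h0 : (jumpChain Q μ₀).map (Preorder.frestrictLe (π := fun _ => S) 0)
      = μ₀.map (MeasurableEquiv.piUnique fun _ : Finset.Iic 0 => S).symm := by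
    change (Measure.bind _ (Kernel.traj (X := fun _ => S) κ 0)).map _ = _
    rw [Measure.map_comp _ _ (by fun_prop), Kernel.traj_map_frestrictLe, Kernel.partialTraj_self,
      Measure.id_comp]
  have h1 : ∫⁻ Y, f (Y 0) ∂jumpChain Q μ₀
      = ∫⁻ p, f (p ⟨0, by simp⟩) ∂(jumpChain Q μ₀).map
          (Preorder.frestrictLe (π := fun _ => S) 0) := by
    rw [lintegral_map (by fun_prop) (by fun_prop)]
    rfl
  rw [h1, h0, lintegral_map (by fun_prop) (by fun_prop)]
  rfl

theorem lintegral_jumpChain (Q : Rates S) (μ₀ : Measure S) [IsProbabilityMeasure μ₀]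
    (n : ℕ) (f : S → ℝ≥0∞) :
    ∫⁻ Y, f (Y n) ∂jumpChain Q μ₀ = ∫⁻ x, (jumpStep Q)^[n] f x ∂μ₀ := by
  induction n generalizing f with
  | zero => exact lintegral_jumpChain_zero Q μ₀ f
  | succ n ih => rw [lintegral_jumpChain_succ, ih, Function.iterate_succ_apply]

instance (Q : Rates S) (μ₀ : Measure S) [IsProbabilityMeasure μ₀] :
    IsProbabilityMeasure (jumpChain Q μ₀) := by
  unfold jumpChain; infer_instance

theorem lintegral_ofReal_expMeasure_one : ∫⁻ x, ENNReal.ofReal x ∂expMeasure 1 = 1 := by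
  have h : ∀ x : ℝ, gammaPDF 1 1 x * ENNReal.ofReal x = gammaPDF 2 1 x := by
    intro x
    rcases lt_or_ge x 0 with hx | hx
    · simp [gammaPDF_of_neg hx]
    · rw [gammaPDF_of_nonneg hx, gammaPDF_of_nonneg hx, ← ENNReal.ofReal_mul (by positivity)]
      congr 1
      norm_num [Real.Gamma_two]
      ring
  rw [expMeasure, gammaMeasure]
  rw [lintegral_withDensity_eq_lintegral_mul _
    (show Measurable (gammaPDF 1 1) from (measurable_gammaPDFReal 1 1).ennreal_ofReal)
    (by fun_prop)]
  simp only [Pi.mul_apply, h]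
  exact lintegral_gammaPDF_eq_one two_pos one_pos

theorem lintegral_absorptionTime (Q : Rates S) (a : S) (μ₀ : Measure S)
    [IsProbabilityMeasure μ₀] :
    ∫⁻ ω, absorptionTime Q a ω ∂pathMeasure Q μ₀ = ∫⁻ x, meanTime Q a x ∂μ₀ := by
  classical
  have hm : Measurable (meanHoldingTime Q a) := Measurable.of_discrete
  have h : ∀ ω : (ℕ → S) × (ℕ → ℝ), absorptionTime Q a ω
      = ∑' n, meanHoldingTime Q a (ω.1 n) * ENNReal.ofReal (ω.2 n) := by
    intro ω
    refine tsum_congr fun n => ?_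
    unfold meanHoldingTime
    split_ifs
    · simp
    · rw [ENNReal.div_eq_inv_mul]
  simp_rw [h]
  rw [lintegral_tsum (fun n => by fun_prop)]
  unfold meanTime
  rw [lintegral_tsum (fun n => Measurable.of_discrete.aemeasurable)]
  refine tsum_congr fun n => ?_
  rw [← lintegral_jumpChain, pathMeasure,
    lintegral_prod_mul (f := fun Y : ℕ → S => meanHoldingTime Q a (Y n))
      (g := fun e : ℕ → ℝ => ENNReal.ofReal (e n))
      (show Measurable _ by fun_prop).aemeasurable
      (show Measurable _ by fun_prop).aemeasurable]
  have := (measurePreserving_eval_infinitePi (fun _ : ℕ => expMeasure 1) n).lintegral_comp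
    (f := ENNReal.ofReal) (by fun_prop)
  simp only [Function.eval] at this
  rw [this, lintegral_ofReal_expMeasure_one, mul_one]

end CTMC

/-! ### Rewards summed over the jobs in the system -/

namespace ElasticQueue

/-- Removing one of `o + n` jobs, where the job at position `r` is removed at rate `a r`: the sum
over the last `n` jobs of a reward `H` that depends on the numbers of older and of younger jobs
can be tracked job by job, and each job sees either an older or a younger job leave. -/
theorem sum_removal (a : ℕ → ℝ≥0∞) (H : ℕ → ℕ → ℝ≥0∞) (o n : ℕ) :
    ∑ q ∈ Finset.range n, ((∑ r ∈ Finset.range (o + q), a r) * H (o + q - 1) (n - 1 - q) +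
        (∑ r ∈ Finset.Ico (o + q + 1) (o + n), a r) * H (o + q) (n - 1 - q - 1)) =
      (∑ r ∈ Finset.range o, a r) * ∑ q ∈ Finset.range n, H (o - 1 + q) (n - 1 - q) +
      (∑ r ∈ Finset.range n, a (o + r)) *
        ∑ q ∈ Finset.range (n - 1), H (o + q) (n - 1 - 1 - q) := by
  rcases n with _ | m
  · simp
  simp only [Finset.sum_range_add a o, Finset.sum_add_distrib, add_mul, add_assoc]
  congr 1
  · rw [Finset.mul_sum]
    refine Finset.sum_congr rfl fun q _ => ?_
    rcases o with _ | o
    · simp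
    · rw [show o + 1 + q - 1 = o + 1 - 1 + q by omega]
  · rw [Finset.sum_range_succ', Finset.sum_range_succ _ m]
    simp only [Finset.range_zero, Finset.sum_empty, zero_mul, add_zero, Finset.Ico_self,
      Nat.add_sub_cancel]
    rw [← Finset.sum_add_distrib, Finset.mul_sum]
    refine Finset.sum_congr rfl fun q hq => ?_
    have hq := Finset.mem_range.1 hq
    rw [show o + (q + 1) - 1 = o + q by omega, show m - (q + 1) = m - 1 - q by omega,
      show m - q - 1 = m - 1 - q by omega, ← add_mul]
    congr 1
    rw [Finset.range_eq_Ico, Finset.range_eq_Ico, Finset.sum_Ico_add, Finset.sum_Ico_add,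
      ← Finset.sum_Ico_consecutive a (m := 0 + o) (n := q + 1 + o) (k := m + 1 + o) (by omega)
        (by omega)]
    congr 2
    congr 1 <;> omega

variable {M : Model} {π : Policy M.k}

/-- The sum of `h` over the inelastic jobs at the positions `o, …, o + n - 1`, when there are
`o + n` inelastic jobs and `j` elastic jobs. -/
noncomputable def sumI (h : Tagged → ℝ≥0∞) (o n j : ℕ) : ℝ≥0∞ :=
  ∑ q ∈ Finset.range n, h (.inelastic (o + q) (n - 1 - q) j)

/-- The sum of `h` over the elastic jobs at the positions `o, …, o + n - 1`, when there are `i`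
inelastic jobs and `o + n` elastic jobs. -/
noncomputable def sumE (h : Tagged → ℝ≥0∞) (i o n : ℕ) : ℝ≥0∞ :=
  ∑ q ∈ Finset.range n, h (.elastic i (o + q) (n - 1 - q))

theorem sumI_succ (h : Tagged → ℝ≥0∞) (o n j : ℕ) :
    sumI h o (n + 1) j = ∑ q ∈ Finset.range n, h (.inelastic (o + q) (n - 1 - q + 1) j) +
      h (.inelastic (o + n) 0 j) := by
  rw [sumI, Finset.sum_range_succ, Nat.add_sub_cancel, Nat.sub_self]
  congr 1
  refine Finset.sum_congr rfl fun q hq => ?_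
  rw [show n - q = n - 1 - q + 1 by have := Finset.mem_range.1 hq; omega]

theorem sumE_succ (h : Tagged → ℝ≥0∞) (i o n : ℕ) :
    sumE h i o (n + 1) = ∑ q ∈ Finset.range n, h (.elastic i (o + q) (n - 1 - q + 1)) +
      h (.elastic i (o + n) 0) := by
  rw [sumE, Finset.sum_range_succ, Nat.add_sub_cancel, Nat.sub_self]
  congr 1
  refine Finset.sum_congr rfl fun q hq => ?_
  rw [show n - q = n - 1 - q + 1 by have := Finset.mem_range.1 hq; omega]

theorem sumI_flow {h : Tagged → ℝ≥0∞} (h0 : h .done = 0) (o n j : ℕ) :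
    sumI (CTMC.flow (taggedRates M π) h) o n j + M.lamI * h (.inelastic (o + n) 0 j) =
      M.lamI * sumI h o (n + 1) j + M.lamE * sumI h o n (j + 1) +
      M.muI * ((∑ r ∈ Finset.range o, π.allocI (o + n) j r : ℝ≥0) * sumI h (o - 1) n j +
        (∑ r ∈ Finset.range n, π.allocI (o + n) j (o + r) : ℝ≥0) * sumI h o (n - 1) j) +
      M.muE * (π.serversE (o + n) j * sumI h o n (j - 1)) := by
  have key := sum_removal (fun r => (π.allocI (o + n) j r : ℝ≥0∞))
    (fun a b => h (.inelastic a b j)) o n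
  have h1 : sumI (CTMC.flow (taggedRates M π) h) o n j =
      ∑ q ∈ Finset.range n, (M.lamI * h (.inelastic (o + q) (n - 1 - q + 1) j) +
        M.lamE * h (.inelastic (o + q) (n - 1 - q) (j + 1)) +
        M.muI * ((∑ r ∈ Finset.range (o + q), (π.allocI (o + n) j r : ℝ≥0∞)) *
            h (.inelastic (o + q - 1) (n - 1 - q) j) +
          (∑ r ∈ Finset.Ico (o + q + 1) (o + n), (π.allocI (o + n) j r : ℝ≥0∞)) *
            h (.inelastic (o + q) (n - 1 - q - 1) j)) +
        M.muE * (π.serversE (o + n) j * h (.inelastic (o + q) (n - 1 - q) (j - 1)))) := by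
    refine Finset.sum_congr rfl fun q hq => ?_
    have hi : o + q + 1 + (n - 1 - q) = o + n := by have := Finset.mem_range.1 hq; omega
    simp only [CTMC.flow, taggedRates, hi, List.map_cons, List.map_nil, List.sum_cons,
      List.sum_nil, h0, ENNReal.coe_mul, ENNReal.ofNNReal_finsetSum]
    ring
  rw [h1, sumI_succ]
  simp only [Finset.sum_add_distrib, ← Finset.mul_sum] at key ⊢
  rw [key]
  simp only [sumI, ENNReal.ofNNReal_finsetSum]
  ring

theorem sumE_flow {h : Tagged → ℝ≥0∞} (h0 : h .done = 0) (i o n : ℕ) :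
    sumE (CTMC.flow (taggedRates M π) h) i o n + M.lamE * h (.elastic i (o + n) 0) =
      M.lamI * sumE h (i + 1) o n + M.lamE * sumE h i o (n + 1) +
      M.muE * ((∑ r ∈ Finset.range o, π.allocE i (o + n) r : ℝ≥0) * sumE h i (o - 1) n +
        (∑ r ∈ Finset.range n, π.allocE i (o + n) (o + r) : ℝ≥0) * sumE h i o (n - 1)) +
      M.muI * (π.serversI i (o + n) * sumE h (i - 1) o n) := by
  have key := sum_removal (fun r => (π.allocE i (o + n) r : ℝ≥0∞))
    (fun a b => h (.elastic i a b)) o n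
  have h1 : sumE (CTMC.flow (taggedRates M π) h) i o n =
      ∑ q ∈ Finset.range n, (M.lamI * h (.elastic (i + 1) (o + q) (n - 1 - q)) +
        M.lamE * h (.elastic i (o + q) (n - 1 - q + 1)) +
        M.muE * ((∑ r ∈ Finset.range (o + q), (π.allocE i (o + n) r : ℝ≥0∞)) *
            h (.elastic i (o + q - 1) (n - 1 - q)) +
          (∑ r ∈ Finset.Ico (o + q + 1) (o + n), (π.allocE i (o + n) r : ℝ≥0∞)) *
            h (.elastic i (o + q) (n - 1 - q - 1))) +
        M.muI * (π.serversI i (o + n) * h (.elastic (i - 1) (o + q) (n - 1 - q)))) := by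
    refine Finset.sum_congr rfl fun q hq => ?_
    have hi : o + q + 1 + (n - 1 - q) = o + n := by have := Finset.mem_range.1 hq; omega
    simp only [CTMC.flow, taggedRates, hi, List.map_cons, List.map_nil, List.sum_cons,
      List.sum_nil, h0, ENNReal.coe_mul, ENNReal.ofNNReal_finsetSum]
    ring
  rw [h1, sumE_succ]
  simp only [Finset.sum_add_distrib, ← Finset.mul_sum] at key ⊢
  rw [key]
  simp only [sumE, ENNReal.ofNNReal_finsetSum]
  ring

theorem Policy.serversI_add {k : ℕ} (π : Policy k) (o n j : ℕ) :
    π.serversI (o + n) j = ∑ r ∈ Finset.range o, π.allocI (o + n) j r +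
      ∑ r ∈ Finset.range n, π.allocI (o + n) j (o + r) :=
  Finset.sum_range_add _ _ _

theorem Policy.serversE_add {k : ℕ} (π : Policy k) (i o n : ℕ) :
    π.serversE i (o + n) = ∑ r ∈ Finset.range o, π.allocE i (o + n) r +
      ∑ r ∈ Finset.range n, π.allocE i (o + n) (o + r) :=
  Finset.sum_range_add _ _ _

/-- The sum of `h` over the `n` youngest inelastic and the `n'` youngest elastic jobs, when there
are moreover `o` older inelastic and `o'` older elastic jobs. -/
noncomputable def jobSum (h : Tagged → ℝ≥0∞) (o n o' n' : ℕ) : ℝ≥0∞ :=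
  sumI h o n (o' + n') + sumE h (o + n) o' n'

/-- The rate at which arriving jobs collect the reward `h` when the system is in state `s`. -/
noncomputable def arrivalReward (M : Model) (h : Tagged → ℝ≥0∞) (s : ℕ × ℕ) : ℝ≥0∞ :=
  M.lamI * h (.inelastic s.1 0 s.2) + M.lamE * h (.elastic s.1 s.2 0)

/-- The generator of the system acts on a sum over jobs through the generator of the system as
seen from each job, up to the contribution of the arriving jobs. -/
theorem jobSum_flow {h : Tagged → ℝ≥0∞} (h0 : h .done = 0) (o n o' n' : ℕ) :
    jobSum (CTMC.flow (taggedRates M π) h) o n o' n' + arrivalReward M h (o + n, o' + n') =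
      M.lamI * jobSum h o (n + 1) o' n' + M.lamE * jobSum h o n o' (n' + 1) +
      M.muI * ((∑ r ∈ Finset.range o, π.allocI (o + n) (o' + n') r : ℝ≥0) *
          jobSum h (o - 1) n o' n' +
        (∑ r ∈ Finset.range n, π.allocI (o + n) (o' + n') (o + r) : ℝ≥0) *
          jobSum h o (n - 1) o' n') +
      M.muE * ((∑ r ∈ Finset.range o', π.allocE (o + n) (o' + n') r : ℝ≥0) *
          jobSum h o n (o' - 1) n' +
        (∑ r ∈ Finset.range n', π.allocE (o + n) (o' + n') (o' + r) : ℝ≥0) *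
          jobSum h o n o' (n' - 1)) := by
  have hI := sumI_flow (M := M) (π := π) h0 o n (o' + n')
  have hE := sumE_flow (M := M) (π := π) h0 (o + n) o' n'
  rw [π.serversE_add, ENNReal.coe_add] at hI
  rw [π.serversI_add, ENNReal.coe_add] at hE
  -- A truncated subtraction below occurs only next to an empty sum.
  have e1 : (∑ r ∈ Finset.range o, π.allocI (o + n) (o' + n') r : ℝ≥0) *
      sumE h (o - 1 + n) o' n' = (∑ r ∈ Finset.range o, π.allocI (o + n) (o' + n') r : ℝ≥0) *
      sumE h (o + n - 1) o' n' := by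
    rcases o with _ | o
    · simp
    · rw [show o + 1 - 1 + n = o + 1 + n - 1 by omega]
  have e2 : (∑ r ∈ Finset.range n, π.allocI (o + n) (o' + n') (o + r) : ℝ≥0) *
      sumE h (o + (n - 1)) o' n' =
      (∑ r ∈ Finset.range n, π.allocI (o + n) (o' + n') (o + r) : ℝ≥0) *
      sumE h (o + n - 1) o' n' := by
    rcases n with _ | n
    · simp
    · rfl
  have e3 : (∑ r ∈ Finset.range o', π.allocE (o + n) (o' + n') r : ℝ≥0) *
      sumI h o n (o' - 1 + n') = (∑ r ∈ Finset.range o', π.allocE (o + n) (o' + n') r : ℝ≥0) *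
      sumI h o n (o' + n' - 1) := by
    rcases o' with _ | o'
    · simp
    · rw [show o' + 1 - 1 + n' = o' + 1 + n' - 1 by omega]
  have e4 : (∑ r ∈ Finset.range n', π.allocE (o + n) (o' + n') (o' + r) : ℝ≥0) *
      sumI h o n (o' + (n' - 1)) =
      (∑ r ∈ Finset.range n', π.allocE (o + n) (o' + n') (o' + r) : ℝ≥0) *
      sumI h o n (o' + n' - 1) := by
    rcases n' with _ | n'
    · simp
    · rfl
  unfold jobSum arrivalReward
  simp only [mul_add, add_mul] at hI hE ⊢
  rw [e1, e2, e3, e4]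
  rw [show ∀ a b c d : ℝ≥0∞, a + b + (c + d) = (a + c) + (b + d) by intros; ring, hI, hE]
  rw [show o + n + 1 = o + (n + 1) by ring, show o' + n' + 1 = o' + (n' + 1) by ring]
  ring

theorem exitRate_taggedRates_inelastic (a b j : ℕ) :
    CTMC.exitRate (taggedRates M π) (.inelastic a b j) =
      CTMC.exitRate (countRates M π) (a + 1 + b, j) := by
  have h : π.serversI (a + 1 + b) j = ∑ p ∈ Finset.range a, π.allocI (a + 1 + b) j p +
      π.allocI (a + 1 + b) j a + ∑ p ∈ Finset.Ico (a + 1) (a + 1 + b), π.allocI (a + 1 + b) j p := by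
    rw [← Finset.sum_range_succ, Finset.sum_range_add_sum_Ico _ (by omega)]
    rfl
  simp only [CTMC.exitRate, taggedRates, countRates, List.map_cons, List.map_nil, List.sum_cons,
      List.sum_nil, h]
  ring

theorem exitRate_taggedRates_elastic (i a b : ℕ) :
    CTMC.exitRate (taggedRates M π) (.elastic i a b) =
      CTMC.exitRate (countRates M π) (i, a + 1 + b) := by
  have h : π.serversE i (a + 1 + b) = ∑ p ∈ Finset.range a, π.allocE i (a + 1 + b) p +
      π.allocE i (a + 1 + b) a + ∑ p ∈ Finset.Ico (a + 1) (a + 1 + b), π.allocE i (a + 1 + b) p := by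
    rw [← Finset.sum_range_succ, Finset.sum_range_add_sum_Ico _ (by omega)]
    rfl
  simp only [CTMC.exitRate, taggedRates, countRates, List.map_cons, List.map_nil, List.sum_cons,
      List.sum_nil, h]
  ring

theorem exitRate_taggedRates_done : CTMC.exitRate (taggedRates M π) .done = 0 := by
  simp [CTMC.exitRate, taggedRates]

theorem lam_le_exitRate_countRates (s : ℕ × ℕ) :
    M.lamI + M.lamE ≤ CTMC.exitRate (countRates M π) s := by
  simp only [CTMC.exitRate, countRates, List.map_cons, List.map_nil, List.sum_cons, List.sum_nil,
    ← add_assoc]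
  exact le_add_right (le_add_right (by simp))

theorem lam_le_exitRate_taggedRates {x : Tagged} (hx : x ≠ .done) :
    M.lamI + M.lamE ≤ CTMC.exitRate (taggedRates M π) x := by
  cases x with
  | inelastic a b j =>
    rw [exitRate_taggedRates_inelastic]; exact lam_le_exitRate_countRates _
  | elastic i a b => rw [exitRate_taggedRates_elastic]; exact lam_le_exitRate_countRates _
  | done => exact absurd rfl hx

theorem exitRate_taggedRates_ne_zero {x : Tagged} (hx : x ≠ .done) :
    CTMC.exitRate (taggedRates M π) x ≠ 0 :=
  ((add_pos M.lamI_pos M.lamE_pos).trans_le (lam_le_exitRate_taggedRates hx)).ne'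

/-- If `f` is obtained from `g` by one step of first-step analysis, then so is its sum over the
jobs. -/
theorem exitRate_mul_jobSum {f g : Tagged → ℝ≥0∞}
    (hf : ∀ x, x ≠ .done →
      CTMC.exitRate (taggedRates M π) x * f x = 1 + CTMC.flow (taggedRates M π) g x)
    (o n o' n' : ℕ) :
    CTMC.exitRate (countRates M π) (o + n, o' + n') * jobSum f o n o' n' =
      (n + n' : ℕ) + jobSum (CTMC.flow (taggedRates M π) g) o n o' n' := by
  have hI : CTMC.exitRate (countRates M π) (o + n, o' + n') * sumI f o n (o' + n') =
      n + sumI (CTMC.flow (taggedRates M π) g) o n (o' + n') := by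
    have : (n : ℝ≥0∞) = ∑ q ∈ Finset.range n, 1 := by simp
    rw [sumI, sumI, this, Finset.mul_sum, ← Finset.sum_add_distrib]
    refine Finset.sum_congr rfl fun q hq => ?_
    rw [← hf _ (by simp), exitRate_taggedRates_inelastic,
      show o + q + 1 + (n - 1 - q) = o + n by have := Finset.mem_range.1 hq; omega]
  have hE : CTMC.exitRate (countRates M π) (o + n, o' + n') * sumE f (o + n) o' n' =
      n' + sumE (CTMC.flow (taggedRates M π) g) (o + n) o' n' := by
    have : (n' : ℝ≥0∞) = ∑ q ∈ Finset.range n', 1 := by simp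
    rw [sumE, sumE, this, Finset.mul_sum, ← Finset.sum_add_distrib]
    refine Finset.sum_congr rfl fun q hq => ?_
    rw [← hf _ (by simp), exitRate_taggedRates_elastic,
      show o' + q + 1 + (n' - 1 - q) = o' + n' by have := Finset.mem_range.1 hq; omega]
  rw [jobSum, mul_add, hI, hE, jobSum]
  push_cast
  ring

theorem lintegral_arrivalLaw (M : Model) (ν : PMF (ℕ × ℕ)) (h : Tagged → ℝ≥0∞) :
    ((M.lamI + M.lamE : ℝ≥0) : ℝ≥0∞) * ∫⁻ x, h x ∂arrivalLaw M ν =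
      ∑' s, ν s * arrivalReward M h s := by
  have hΛ : M.lamI + M.lamE ≠ 0 := (add_pos M.lamI_pos M.lamE_pos).ne'
  rw [arrivalLaw, Measure.lintegral_bind Measurable.of_discrete.aemeasurable
    Measurable.of_discrete.aemeasurable, lintegral_countable', ← ENNReal.tsum_mul_left]
  refine tsum_congr fun s => ?_
  rw [PMF.toMeasure_apply_singleton _ _ (measurableSet_singleton s), lintegral_add_measure,
    lintegral_smul_measure, lintegral_smul_measure, lintegral_dirac, lintegral_dirac,
    arrivalReward, ← mul_assoc, mul_comm _ (ν s)]
  congr 1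
  rw [smul_eq_mul, smul_eq_mul, mul_add, ← mul_assoc, ← mul_assoc, ← ENNReal.coe_mul,
    ← ENNReal.coe_mul, mul_div_cancel₀ _ hΛ,
    mul_div_cancel₀ _ hΛ]

instance (M : Model) (ν : PMF (ℕ × ℕ)) : IsProbabilityMeasure (arrivalLaw M ν) := by
  have hΛ : M.lamI + M.lamE ≠ 0 := (add_pos M.lamI_pos M.lamE_pos).ne'
  have h := lintegral_arrivalLaw M ν (fun _ => 1)
  simp only [arrivalReward, mul_one, ← ENNReal.coe_add, ENNReal.tsum_mul_right, PMF.tsum_coe,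
    lintegral_const, one_mul] at h
  refine ⟨?_⟩
  have h2 : ((M.lamI + M.lamE : ℝ≥0) : ℝ≥0∞) * arrivalLaw M ν Set.univ =
    ((M.lamI + M.lamE : ℝ≥0) : ℝ≥0∞) * 1 := by rw [h, mul_one]
  exact (ENNReal.mul_right_inj (by exact_mod_cast hΛ) ENNReal.coe_ne_top).1 h2

theorem exitRate_countRates_le (s : ℕ × ℕ) :
    CTMC.exitRate (countRates M π) s ≤ M.lamI + M.lamE + M.k * (M.muI + M.muE) := by
  have h : π.serversI s.1 s.2 + π.serversE s.1 s.2 ≤ M.k := π.total_le s.1 s.2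
  have hI : M.muI * π.serversI s.1 s.2 ≤ M.muI * M.k :=
    mul_le_mul_right (le_self_add.trans h) _
  have hE : M.muE * π.serversE s.1 s.2 ≤ M.muE * M.k :=
    mul_le_mul_right (le_add_self.trans h) _
  simp only [CTMC.exitRate, countRates, List.map_cons, List.map_nil, List.sum_cons, List.sum_nil]
  calc M.lamI + (M.lamE + (M.muI * π.serversI s.1 s.2 + (M.muE * π.serversE s.1 s.2 + 0)))
      ≤ M.lamI + (M.lamE + (M.muI * M.k + (M.muE * M.k + 0))) := by gcongr
    _ = _ := by ring

theorem jobSum_flow_countRates {h : Tagged → ℝ≥0∞} (h0 : h .done = 0) (s : ℕ × ℕ) :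
    jobSum (CTMC.flow (taggedRates M π) h) 0 s.1 0 s.2 + arrivalReward M h s =
      CTMC.flow (countRates M π) (fun s => jobSum h 0 s.1 0 s.2) s := by
  have := jobSum_flow (M := M) (π := π) h0 0 s.1 0 s.2
  simp only [zero_add, Finset.range_zero, Finset.sum_empty, ENNReal.coe_zero, zero_mul] at this
  rw [this]
  simp only [CTMC.flow, countRates, List.map_cons, List.map_nil, List.sum_cons, List.sum_nil,
    Policy.serversI, Policy.serversE, ENNReal.coe_mul]
  ring

theorem meanTime_done : CTMC.meanTime (taggedRates M π) .done .done = 0 :=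
  CTMC.meanTime_self exitRate_taggedRates_done

/-- The inequality of Little's law that holds for every policy: the mean number of jobs in the
system bounds the arrival rate times the mean response time. (It is strict if some jobs stay in
the system forever.) -/
theorem lam_mul_lintegral_responseTime_le {ν : PMF (ℕ × ℕ)}
    (hν : CTMC.IsStationary (countRates M π) ν) :
    ((M.lamI + M.lamE : ℝ≥0) : ℝ≥0∞) *
      ∫⁻ ω, responseTime M π ω ∂CTMC.pathMeasure (taggedRates M π) (arrivalLaw M ν) ≤
      ∑' s, ν s * ((s.1 + s.2 : ℕ) : ℝ≥0∞) := by
  unfold responseTime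
  rw [CTMC.lintegral_absorptionTime, lintegral_arrivalLaw]
  rcases eq_or_ne (∑' s, ν s * ((s.1 + s.2 : ℕ) : ℝ≥0∞)) ∞ with hC | hC
  · rw [hC]; exact le_top
  set h : ℕ → Tagged → ℝ≥0∞ := CTMC.meanTimeUpTo (taggedRates M π) .done with hh
  have hmono : Monotone h := CTMC.meanTimeUpTo_mono _ _
  -- The inequality for the time up to the `n`-th jump, by the stationarity of the mean of the
  -- sum of `h n` over the jobs in the system.
  have hn : ∀ n, ∑' s, ν s * arrivalReward M (h n) s ≤ ∑' s, ν s * ((s.1 + s.2 : ℕ) : ℝ≥0∞) := by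
    intro n
    set W : ℕ → ℕ × ℕ → ℝ≥0∞ := fun n s => jobSum (h n) 0 s.1 0 s.2 with hW
    set I : ℕ → ℝ≥0∞ := fun n =>
      ∑' s, ν s * (CTMC.exitRate (countRates M π) s * W n s) with hI
    have h1 : I (n + 1) = ∑' s, ν s * ((s.1 + s.2 : ℕ) : ℝ≥0∞) +
        ∑' s, ν s * jobSum (CTMC.flow (taggedRates M π) (h n)) 0 s.1 0 s.2 := by
      rw [← ENNReal.tsum_add]
      refine tsum_congr fun s => ?_
      rw [← mul_add]
      congr 1
      have := exitRate_mul_jobSum (M := M) (π := π) (f := h (n + 1)) (g := h n)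
        (fun x hx => CTMC.exitRate_mul_meanTimeUpTo_succ hx (exitRate_taggedRates_ne_zero hx) n)
        0 s.1 0 s.2
      simpa using this
    have h2 : I n = ∑' s, ν s * jobSum (CTMC.flow (taggedRates M π) (h n)) 0 s.1 0 s.2 +
        ∑' s, ν s * arrivalReward M (h n) s := by
      rw [← ENNReal.tsum_add, hI]
      simp only
      rw [← hν.tsum_flow]
      refine tsum_congr fun s => ?_
      rw [← mul_add, jobSum_flow_countRates
        (CTMC.meanTimeUpTo_self exitRate_taggedRates_done n)]
    have h3 : I n ≤ I (n + 1) := by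
      refine ENNReal.tsum_le_tsum fun s => mul_le_mul_right (mul_le_mul_right ?_ _) _
      refine add_le_add ?_ ?_ <;>
        exact Finset.sum_le_sum fun q _ => hmono n.le_succ _
    have h4 : I n ≠ ∞ := by
      set b : ℝ≥0∞ := n * ((M.lamI + M.lamE : ℝ≥0) : ℝ≥0∞)⁻¹ with hb
      have hbt : b ≠ ∞ := ENNReal.mul_ne_top (ENNReal.natCast_ne_top n) (ENNReal.inv_ne_top.2
        (by exact_mod_cast (add_pos M.lamI_pos M.lamE_pos).ne'))
      have hle : ∀ x, h n x ≤ b := fun x => CTMC.meanTimeUpTo_le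
        (fun x hx => by exact_mod_cast lam_le_exitRate_taggedRates hx) n x
      set U : ℝ≥0∞ := ((M.lamI + M.lamE + M.k * (M.muI + M.muE) : ℝ≥0) : ℝ≥0∞) with hU
      have hIle : I n ≤ ∑' s, U * b * (ν s * ((s.1 + s.2 : ℕ) : ℝ≥0∞)) := by
        refine ENNReal.tsum_le_tsum fun s => ?_
        have e1 : (CTMC.exitRate (countRates M π) s : ℝ≥0∞) ≤ U :=
          ENNReal.coe_le_coe.2 (exitRate_countRates_le s)
        have e2 : W n s ≤ b * ((s.1 + s.2 : ℕ) : ℝ≥0∞) := by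
          rw [Nat.cast_add, mul_add]
          refine add_le_add ?_ ?_
          · refine (Finset.sum_le_card_nsmul _ _ b fun q _ => hle _).trans ?_
            simp [mul_comm]
          · refine (Finset.sum_le_card_nsmul _ _ b fun q _ => hle _).trans ?_
            simp [mul_comm]
        calc ν s * (CTMC.exitRate (countRates M π) s * W n s)
            ≤ ν s * (U * (b * ((s.1 + s.2 : ℕ) : ℝ≥0∞))) := by gcongr
          _ = _ := by ring
      rw [ENNReal.tsum_mul_left] at hIle
      exact ne_top_of_le_ne_top
        (ENNReal.mul_ne_top (ENNReal.mul_ne_top ENNReal.coe_ne_top hbt) hC) hIle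
    rw [h1, h2] at h3
    rw [h2] at h4
    rw [add_comm (∑' s, ν s * ((s.1 + s.2 : ℕ) : ℝ≥0∞))] at h3
    exact (ENNReal.add_le_add_iff_left (ne_top_of_le_ne_top h4 le_self_add)).1 h3
  have hsup : ∑' s, ν s * arrivalReward M (CTMC.meanTime (taggedRates M π) .done) s =
      ⨆ n, ∑' s, ν s * arrivalReward M (h n) s := by
    simp_rw [← lintegral_arrivalLaw, ← ENNReal.mul_iSup, CTMC.meanTime_eq_iSup]
    rw [lintegral_iSup (fun _ => Measurable.of_discrete) hmono]
  rw [hsup]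
  exact iSup_le hn

end ElasticQueue

/-! ### Coupling with a work-conserving system -/

namespace ElasticQueue

variable (M : Model) (π : Policy M.k)

/-- The states of the coupled systems. In `(o, c, d, o', c', d')`, the system under the given
policy has `o` old and `c + d` new inelastic jobs and `o'` old and `c' + d'` new elastic jobs,
where a job is old if it was there at time `0`, and the work-conserving system has `c` inelastic
and `c'` elastic jobs. -/
abbrev Coupled : Type := ℕ × ℕ × ℕ × ℕ × ℕ × ℕ

/-- The servers given to the inelastic jobs by the work-conserving system when it has `c`
inelastic and `c'` elastic jobs and the other system gives `x` servers to its new inelastic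
jobs. -/
noncomputable def followI (k : ℕ) (x : ℝ≥0) (c c' : ℕ) : ℝ≥0 :=
  if 0 < c' then min x c else min c k

/-- The servers given to the elastic jobs by the work-conserving system: all that are left. -/
noncomputable def followE (k : ℕ) (x : ℝ≥0) (c c' : ℕ) : ℝ≥0 :=
  if 0 < c' then k - followI k x c c' else 0

/-- A common bound for the exit rates of the coupled systems. -/
noncomputable def uniformRate (M : Model) : ℝ≥0 :=
  M.lamI + M.lamE + 2 * M.k * (M.muI + M.muE)

variable {M}

/-- The servers given to the old inelastic jobs. -/
noncomputable def oldI (z : Coupled) : ℝ≥0 :=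
  match z with
  | (o, c, d, o', c', d') => ∑ r ∈ Finset.range o, π.allocI (o + (c + d)) (o' + (c' + d')) r

/-- The servers given to the new inelastic jobs. -/
noncomputable def newI (z : Coupled) : ℝ≥0 :=
  match z with
  | (o, c, d, o', c', d') =>
    ∑ r ∈ Finset.range (c + d), π.allocI (o + (c + d)) (o' + (c' + d')) (o + r)

/-- The servers given to the old elastic jobs. -/
noncomputable def oldE (z : Coupled) : ℝ≥0 :=
  match z with
  | (o, c, d, o', c', d') => ∑ r ∈ Finset.range o', π.allocE (o + (c + d)) (o' + (c' + d')) r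

/-- The servers given to the new elastic jobs. -/
noncomputable def newE (z : Coupled) : ℝ≥0 :=
  match z with
  | (o, c, d, o', c', d') =>
    ∑ r ∈ Finset.range (c' + d'), π.allocE (o + (c + d)) (o' + (c' + d')) (o' + r)

/-- The servers given to the inelastic jobs in the work-conserving system. -/
noncomputable def wcI (z : Coupled) : ℝ≥0 := followI M.k (newI π z) z.2.1 z.2.2.2.2.1

/-- The servers given to the elastic jobs in the work-conserving system. -/
noncomputable def wcE (z : Coupled) : ℝ≥0 := followE M.k (newI π z) z.2.1 z.2.2.2.2.1

/-- The transitions that change the state of the coupled systems: arrivals occur in both systems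
at once, and so do completions of new jobs as far as the service rates allow. -/
noncomputable def coupledMoves (z : Coupled) : List (ℝ≥0 × Coupled) :=
  match z with
  | (o, c, d, o', c', d') =>
    [(M.lamI, (o, c + 1, d, o', c', d')),
     (M.lamE, (o, c, d, o', c' + 1, d')),
     (M.muI * oldI π z, (o - 1, c, d, o', c', d')),
     (M.muI * min (newI π z) (wcI π z), (o, c - 1, d, o', c', d')),
     (M.muI * (newI π z - wcI π z), (o, c, d - 1, o', c', d')),
     (M.muI * (wcI π z - newI π z), (o, c - 1, d + 1, o', c', d')),
     (M.muE * oldE π z, (o, c, d, o' - 1, c', d')),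
     (M.muE * min (newE π z) (wcE π z), (o, c, d, o', c' - 1, d')),
     (M.muE * (newE π z - wcE π z), (o, c, d, o', c', d' - 1)),
     (M.muE * (wcE π z - newE π z), (o, c, d, o', c' - 1, d' + 1))]

/-- The coupled systems, with void transitions that make all exit rates equal to
`uniformRate M`. -/
noncomputable def coupledRates : CTMC.Rates Coupled := fun z =>
  (uniformRate M - CTMC.exitRate (coupledMoves π) z, z) :: coupledMoves π z

variable {π}

theorem servers_eq (o c d o' c' d' : ℕ) :
    π.serversI (o + (c + d)) (o' + (c' + d')) =
        oldI π (o, c, d, o', c', d') + newI π (o, c, d, o', c', d') ∧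
      π.serversE (o + (c + d)) (o' + (c' + d')) =
        oldE π (o, c, d, o', c', d') + newE π (o, c, d, o', c', d') :=
  ⟨π.serversI_add _ _ _, π.serversE_add _ _ _⟩

theorem old_add_new_le (z : Coupled) :
    oldI π z + newI π z + (oldE π z + newE π z) ≤ M.k := by
  obtain ⟨o, c, d, o', c', d'⟩ := z
  rw [← (servers_eq o c d o' c' d').1, ← (servers_eq o c d o' c' d').2]
  exact π.total_le _ _

theorem newI_le_card (z : Coupled) : newI π z ≤ (z.2.1 + z.2.2.1 : ℕ) := by
  obtain ⟨o, c, d, o', c', d'⟩ := z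
  refine (Finset.sum_le_card_nsmul _ _ 1 fun r hr => π.allocI_le_one _ _ _ ?_).trans ?_
  · have := Finset.mem_range.1 hr; omega
  · simp

theorem newI_le (z : Coupled) : newI π z ≤ M.k :=
  (le_add_self.trans le_self_add).trans (old_add_new_le z)

theorem wcI_le (z : Coupled) : wcI π z ≤ z.2.1 := by
  unfold wcI followI
  split_ifs
  · exact min_le_right _ _
  · exact min_le_left _ _

theorem wcI_le_servers (z : Coupled) : wcI π z ≤ M.k := by
  unfold wcI followI
  split_ifs
  · exact (min_le_left _ _).trans (newI_le z)
  · exact min_le_right _ _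

theorem wcI_add_wcE_of_pos {z : Coupled} (hz : 0 < z.2.2.2.2.1) : wcI π z + wcE π z = M.k := by
  have h : wcE π z = M.k - wcI π z := if_pos hz
  rw [h, add_tsub_cancel_of_le (wcI_le_servers z)]

theorem wcE_of_eq_zero {z : Coupled} (hz : z.2.2.2.2.1 = 0) : wcE π z = 0 :=
  if_neg (by omega)

theorem wcI_of_eq_zero {z : Coupled} (hz : z.2.2.2.2.1 = 0) :
    wcI π z = min (z.2.1 : ℝ≥0) M.k := if_neg (by omega)

theorem wcE_le_servers (z : Coupled) : wcE π z ≤ M.k := by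
  rcases Nat.eq_zero_or_pos z.2.2.2.2.1 with h | h
  · rw [wcE_of_eq_zero h]; exact zero_le
  · exact le_add_self.trans (wcI_add_wcE_of_pos h).le

/-- Without a surplus of inelastic jobs, the work-conserving system serves its inelastic jobs at
least as fast, so that it cannot fall behind. -/
theorem newI_le_wcI {z : Coupled} (hz : z.2.2.1 = 0) : newI π z ≤ wcI π z := by
  have h : newI π z ≤ (z.2.1 : ℝ≥0) := by simpa [hz] using newI_le_card z
  unfold wcI followI
  split_ifs
  · exact le_min le_rfl h
  · exact le_min h (newI_le z)

/-- Without a surplus of elastic jobs, the work-conserving system serves its elastic jobs at least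
as fast, because it leaves as many servers to them. -/
theorem newE_le_wcE {z : Coupled} (hz : z.2.2.2.2.2 = 0) : newE π z ≤ wcE π z := by
  rcases Nat.eq_zero_or_pos z.2.2.2.2.1 with h | h
  · obtain ⟨o, c, d, o', c', d'⟩ := z
    simp only at hz h
    subst hz h
    simp [newE]
  · have h1 : wcE π z = M.k - wcI π z := if_pos h
    have h2 : wcI π z = min (newI π z) z.2.1 := if_pos h
    have h3 : newE π z + newI π z ≤ M.k := by
      refine le_trans ?_ (old_add_new_le (π := π) z)
      rw [add_comm]
      exact add_le_add le_add_self le_add_self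
    rw [h1]
    exact le_tsub_of_add_le_right
      ((add_le_add_right (h2.le.trans (min_le_left _ _)) (newE π z)).trans h3)

theorem min_add_sub_eq (a b : ℝ≥0) : min a b + (b - a) = b := by
  rcases le_total a b with h | h
  · rw [min_eq_left h, add_tsub_cancel_of_le h]
  · rw [min_eq_right h, tsub_eq_zero_of_le h, add_zero]

theorem exitRate_coupledMoves_le (z : Coupled) :
    CTMC.exitRate (coupledMoves π) z ≤ uniformRate M := by
  have hold := old_add_new_le (π := π) z
  have h1 : ∀ a b : ℝ≥0, min a b + ((a - b) + (b - a)) ≤ a + b := by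
    intro a b
    calc min a b + ((a - b) + (b - a)) = (min a b + (b - a)) + (a - b) := by ring
      _ = b + (a - b) := by rw [min_add_sub_eq]
      _ ≤ b + a := by gcongr; exact tsub_le_self
      _ = a + b := add_comm _ _
  have hI : oldI π z + (min (newI π z) (wcI π z) +
      ((newI π z - wcI π z) + (wcI π z - newI π z))) ≤ 2 * M.k := by
    calc _ ≤ oldI π z + (newI π z + wcI π z) := add_le_add le_rfl (h1 _ _)
      _ = (oldI π z + newI π z) + wcI π z := by ring
      _ ≤ M.k + M.k := add_le_add (le_self_add.trans hold) (wcI_le_servers z)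
      _ = _ := by ring
  have hE : oldE π z + (min (newE π z) (wcE π z) +
      ((newE π z - wcE π z) + (wcE π z - newE π z))) ≤ 2 * M.k := by
    calc _ ≤ oldE π z + (newE π z + wcE π z) := add_le_add le_rfl (h1 _ _)
      _ = (oldE π z + newE π z) + wcE π z := by ring
      _ ≤ M.k + M.k := add_le_add (le_add_self.trans hold) (wcE_le_servers z)
      _ = _ := by ring
  calc CTMC.exitRate (coupledMoves π) z
      = M.lamI + M.lamE + (M.muI * (oldI π z + (min (newI π z) (wcI π z) +
          ((newI π z - wcI π z) + (wcI π z - newI π z)))) +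
        M.muE * (oldE π z + (min (newE π z) (wcE π z) +
          ((newE π z - wcE π z) + (wcE π z - newE π z))))) := by
        simp only [CTMC.exitRate, coupledMoves, List.map_cons, List.map_nil, List.sum_cons,
          List.sum_nil]
        ring
    _ ≤ M.lamI + M.lamE + (M.muI * (2 * M.k) + M.muE * (2 * M.k)) := by gcongr
    _ = uniformRate M := by unfold uniformRate; ring

theorem exitRate_coupledRates (z : Coupled) :
    CTMC.exitRate (coupledRates π) z = uniformRate M :=
  tsub_add_cancel_of_le (exitRate_coupledMoves_le z)

theorem uniformRate_pos : 0 < uniformRate M :=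
  (add_pos M.lamI_pos M.lamE_pos).trans_le le_self_add

/-- On functions of the numbers of old and new jobs under `π`, the coupled systems act as the
system under `π` alone. -/
theorem flow_coupledRates_left (g : ℕ → ℕ → ℕ → ℕ → ℝ≥0∞) (o c d o' c' d' : ℕ) :
    CTMC.flow (coupledRates π)
        (fun z => g z.1 (z.2.1 + z.2.2.1) z.2.2.2.1 (z.2.2.2.2.1 + z.2.2.2.2.2))
        (o, c, d, o', c', d') =
      M.lamI * g o (c + d + 1) o' (c' + d') + M.lamE * g o (c + d) o' (c' + d' + 1) +
      M.muI * (oldI π (o, c, d, o', c', d') * g (o - 1) (c + d) o' (c' + d') +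
        newI π (o, c, d, o', c', d') * g o (c + d - 1) o' (c' + d')) +
      M.muE * (oldE π (o, c, d, o', c', d') * g o (c + d) (o' - 1) (c' + d') +
        newE π (o, c, d, o', c', d') * g o (c + d) o' (c' + d' - 1)) +
      (uniformRate M - CTMC.exitRate (countRates M π) (o + (c + d), o' + (c' + d')) : ℝ≥0) *
        g o (c + d) o' (c' + d') := by
  set z : Coupled := (o, c, d, o', c', d') with hz
  have eI := newI_le_wcI (π := π) (z := z)
  have eE := newE_le_wcE (π := π) (z := z)
  have wI := wcI_le (π := π) z
  have wE := wcE_of_eq_zero (π := π) (z := z)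
  have hle := exitRate_coupledMoves_le (π := π) z
  have hq : CTMC.exitRate (coupledMoves π) z =
      CTMC.exitRate (countRates M π) (o + (c + d), o' + (c' + d')) +
      (M.muI * (wcI π z - newI π z) + M.muE * (wcE π z - newE π z)) := by
    have hx : M.muI * newI π z =
        M.muI * min (newI π z) (wcI π z) + M.muI * (newI π z - wcI π z) := by
      rw [← mul_add, min_comm, min_add_sub_eq]
    have hy : M.muE * newE π z =
        M.muE * min (newE π z) (wcE π z) + M.muE * (newE π z - wcE π z) := by
      rw [← mul_add, min_comm, min_add_sub_eq]
    simp only [CTMC.exitRate, countRates, (servers_eq o c d o' c' d').1,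
      (servers_eq o c d o' c' d').2, ← hz, coupledMoves, List.map_cons, List.map_nil,
      List.sum_cons, List.sum_nil, mul_add, hx, hy]
    ring
  have hnull : uniformRate M - CTMC.exitRate (countRates M π) (o + (c + d), o' + (c' + d')) =
      (uniformRate M - CTMC.exitRate (coupledMoves π) z) +
      (M.muI * (wcI π z - newI π z) + M.muE * (wcE π z - newE π z)) := by
    rw [hq] at hle ⊢
    rw [← tsub_tsub, tsub_add_cancel_of_le (le_tsub_of_add_le_left hle)]
  have hsI : (newI π z : ℝ≥0∞) =
      ((min (newI π z) (wcI π z) : ℝ≥0) : ℝ≥0∞) + ((newI π z - wcI π z : ℝ≥0) : ℝ≥0∞) := by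
    rw [← ENNReal.coe_add, min_comm, min_add_sub_eq]
  have hsE : (newE π z : ℝ≥0∞) =
      ((min (newE π z) (wcE π z) : ℝ≥0) : ℝ≥0∞) + ((newE π z - wcE π z : ℝ≥0) : ℝ≥0∞) := by
    rw [← ENNReal.coe_add, min_comm, min_add_sub_eq]
  -- The truncated subtractions at `0` occur only with rate `0`.
  have a1 : ((min (newI π z) (wcI π z) : ℝ≥0) : ℝ≥0∞) * g o (c - 1 + d) o' (c' + d') =
      ((min (newI π z) (wcI π z) : ℝ≥0) : ℝ≥0∞) * g o (c + d - 1) o' (c' + d') := by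
    rcases Nat.eq_zero_or_pos c with h | h
    · have : wcI π z = 0 := by simpa [hz, h] using wI
      simp [this]
    · rw [show c - 1 + d = c + d - 1 by omega]
  have a2 : ((newI π z - wcI π z : ℝ≥0) : ℝ≥0∞) * g o (c + (d - 1)) o' (c' + d') =
      ((newI π z - wcI π z : ℝ≥0) : ℝ≥0∞) * g o (c + d - 1) o' (c' + d') := by
    rcases Nat.eq_zero_or_pos d with h | h
    · rw [tsub_eq_zero_of_le (eI h)]; simp
    · rw [show c + (d - 1) = c + d - 1 by omega]
  have a3 : ((wcI π z - newI π z : ℝ≥0) : ℝ≥0∞) * g o (c - 1 + (d + 1)) o' (c' + d') =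
      ((wcI π z - newI π z : ℝ≥0) : ℝ≥0∞) * g o (c + d) o' (c' + d') := by
    rcases Nat.eq_zero_or_pos c with h | h
    · have : wcI π z = 0 := by simpa [hz, h] using wI
      simp [this]
    · rw [show c - 1 + (d + 1) = c + d by omega]
  have b1 : ((min (newE π z) (wcE π z) : ℝ≥0) : ℝ≥0∞) * g o (c + d) o' (c' - 1 + d') =
      ((min (newE π z) (wcE π z) : ℝ≥0) : ℝ≥0∞) * g o (c + d) o' (c' + d' - 1) := by
    rcases Nat.eq_zero_or_pos c' with h | h
    · simp [wE h]
    · rw [show c' - 1 + d' = c' + d' - 1 by omega]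
  have b2 : ((newE π z - wcE π z : ℝ≥0) : ℝ≥0∞) * g o (c + d) o' (c' + (d' - 1)) =
      ((newE π z - wcE π z : ℝ≥0) : ℝ≥0∞) * g o (c + d) o' (c' + d' - 1) := by
    rcases Nat.eq_zero_or_pos d' with h | h
    · rw [tsub_eq_zero_of_le (eE h)]; simp
    · rw [show c' + (d' - 1) = c' + d' - 1 by omega]
  have b3 : ((wcE π z - newE π z : ℝ≥0) : ℝ≥0∞) * g o (c + d) o' (c' - 1 + (d' + 1)) =
      ((wcE π z - newE π z : ℝ≥0) : ℝ≥0∞) * g o (c + d) o' (c' + d') := by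
    rcases Nat.eq_zero_or_pos c' with h | h
    · simp [wE h]
    · rw [show c' - 1 + (d' + 1) = c' + d' by omega]
  rw [hnull, hsI, hsE]
  simp only [CTMC.flow, coupledRates, coupledMoves, hz, List.map_cons, List.map_nil,
    List.sum_cons, List.sum_nil, ENNReal.coe_mul, ENNReal.coe_add, mul_assoc]
  simp only [← hz, a1, a2, a3, b1, b2, b3, show c + 1 + d = c + d + 1 by ring,
    show c' + 1 + d' = c' + d' + 1 by ring]
  ring

/-- On functions of the state of the work-conserving system, the coupled systems act as a system
with the service rates `wcI` and `wcE`. -/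
theorem flow_coupledRates_right (f : ℕ × ℕ → ℝ≥0∞) (z : Coupled) :
    CTMC.flow (coupledRates π) (fun z => f (z.2.1, z.2.2.2.2.1)) z +
      (M.lamI + M.lamE + M.muI * wcI π z + M.muE * wcE π z) * f (z.2.1, z.2.2.2.2.1) =
    M.lamI * f (z.2.1 + 1, z.2.2.2.2.1) + M.lamE * f (z.2.1, z.2.2.2.2.1 + 1) +
      M.muI * (wcI π z * f (z.2.1 - 1, z.2.2.2.2.1)) +
      M.muE * (wcE π z * f (z.2.1, z.2.2.2.2.1 - 1)) +
      uniformRate M * f (z.2.1, z.2.2.2.2.1) := by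
  have hU : (uniformRate M : ℝ≥0∞) =
      ((uniformRate M - CTMC.exitRate (coupledMoves π) z : ℝ≥0) : ℝ≥0∞) +
        CTMC.exitRate (coupledMoves π) z := by
    rw [← ENNReal.coe_add, tsub_add_cancel_of_le (exitRate_coupledMoves_le z)]
  have hsI : (wcI π z : ℝ≥0∞) =
      ((min (newI π z) (wcI π z) : ℝ≥0) : ℝ≥0∞) + ((wcI π z - newI π z : ℝ≥0) : ℝ≥0∞) := by
    rw [← ENNReal.coe_add, min_add_sub_eq]
  have hsE : (wcE π z : ℝ≥0∞) =
      ((min (newE π z) (wcE π z) : ℝ≥0) : ℝ≥0∞) + ((wcE π z - newE π z : ℝ≥0) : ℝ≥0∞) := by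
    rw [← ENNReal.coe_add, min_add_sub_eq]
  have hq : (CTMC.exitRate (coupledMoves π) z : ℝ≥0∞) = M.lamI + M.lamE +
      M.muI * (oldI π z + ((min (newI π z) (wcI π z) : ℝ≥0) : ℝ≥0∞) +
        ((newI π z - wcI π z : ℝ≥0) : ℝ≥0∞) + ((wcI π z - newI π z : ℝ≥0) : ℝ≥0∞)) +
      M.muE * (oldE π z + ((min (newE π z) (wcE π z) : ℝ≥0) : ℝ≥0∞) +
        ((newE π z - wcE π z : ℝ≥0) : ℝ≥0∞) + ((wcE π z - newE π z : ℝ≥0) : ℝ≥0∞)) := by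
    simp only [CTMC.exitRate, coupledMoves, List.map_cons, List.map_nil, List.sum_cons,
      List.sum_nil]
    push_cast
    ring
  rw [hU, hq, hsI, hsE]
  simp only [CTMC.flow, coupledRates, coupledMoves, List.map_cons, List.map_nil,
    List.sum_cons, List.sum_nil, ENNReal.coe_mul, mul_assoc]
  ring

end ElasticQueue

/-! ### Occupation measures of the work-conserving system -/

namespace ElasticQueue

variable {M : Model} {π : Policy M.k} {ν : PMF (ℕ × ℕ)}

/-- The expectation of `f` after `n` transitions of the coupled systems, when the system under `π`
starts with the distribution `ν`, with old jobs only, and the work-conserving system is empty. -/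
noncomputable def coupledMean (π : Policy M.k) (ν : PMF (ℕ × ℕ)) (n : ℕ) (f : Coupled → ℝ≥0∞) :
    ℝ≥0∞ :=
  ∫⁻ Y, f (Y n) ∂CTMC.jumpChain (coupledRates π)
    (ν.toMeasure.map fun s => ((s.1, 0, 0, s.2, 0, 0) : Coupled))

theorem isProbabilityMeasure_start (ν : PMF (ℕ × ℕ)) :
    IsProbabilityMeasure (ν.toMeasure.map fun s => ((s.1, 0, 0, s.2, 0, 0) : Coupled)) :=
  Measure.isProbabilityMeasure_map Measurable.of_discrete.aemeasurable

theorem coupledMean_zero (f : Coupled → ℝ≥0∞) :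
    coupledMean π ν 0 f = ∑' s, ν s * f (s.1, 0, 0, s.2, 0, 0) := by
  have := isProbabilityMeasure_start ν
  rw [coupledMean, CTMC.lintegral_jumpChain_zero,
    lintegral_map Measurable.of_discrete Measurable.of_discrete, lintegral_countable']
  refine tsum_congr fun s => ?_
  rw [PMF.toMeasure_apply_singleton _ _ (measurableSet_singleton s), mul_comm]

theorem uniformRate_mul_coupledMean_succ (n : ℕ) (f : Coupled → ℝ≥0∞) :
    uniformRate M * coupledMean π ν (n + 1) f =
      coupledMean π ν n (CTMC.flow (coupledRates π) f) := by
  have := isProbabilityMeasure_start ν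
  rw [coupledMean, CTMC.lintegral_jumpChain_succ, ← lintegral_const_mul _
    (show Measurable fun Y : ℕ → Coupled => CTMC.jumpStep (coupledRates π) f (Y n) from
      (Measurable.of_discrete (f := CTMC.jumpStep (coupledRates π) f)).comp
        (measurable_pi_apply n))]
  refine lintegral_congr fun Y => ?_
  have h := CTMC.exitRate_mul_jumpStep (Q := coupledRates π) (x := Y n)
    (by rw [exitRate_coupledRates]; exact uniformRate_pos.ne') f
  rwa [exitRate_coupledRates] at h

theorem coupledMean_add (n : ℕ) (f g : Coupled → ℝ≥0∞) :
    coupledMean π ν n (fun z => f z + g z) = coupledMean π ν n f + coupledMean π ν n g :=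
  lintegral_add_left (Measurable.of_discrete.comp (measurable_pi_apply n)) _

theorem coupledMean_const_mul (n : ℕ) (r : ℝ≥0∞) (f : Coupled → ℝ≥0∞) :
    coupledMean π ν n (fun z => r * f z) = r * coupledMean π ν n f :=
  lintegral_const_mul _ (Measurable.of_discrete.comp (measurable_pi_apply n))

theorem coupledMean_tsum (n : ℕ) (f : ℕ × ℕ → Coupled → ℝ≥0∞) :
    coupledMean π ν n (fun z => ∑' s, f s z) = ∑' s, coupledMean π ν n (f s) :=
  lintegral_tsum fun _ => (Measurable.of_discrete.comp (measurable_pi_apply n)).aemeasurable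

theorem coupledMean_mono (n : ℕ) {f g : Coupled → ℝ≥0∞} (h : ∀ z, f z ≤ g z) :
    coupledMean π ν n f ≤ coupledMean π ν n g := lintegral_mono fun _ => h _

theorem coupledMean_one (n : ℕ) : coupledMean π ν n (fun _ => 1) = 1 := by
  have := isProbabilityMeasure_start ν
  simp [coupledMean]

/-- The system under `π` keeps its stationary distribution in the coupling. -/
theorem coupledMean_left (hν : CTMC.IsStationary (countRates M π) ν) (n : ℕ)
    (F : ℕ × ℕ → ℝ≥0∞) :
    coupledMean π ν n
        (fun z => F (z.1 + (z.2.1 + z.2.2.1), z.2.2.2.1 + (z.2.2.2.2.1 + z.2.2.2.2.2))) =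
      ∑' s, ν s * F s := by
  induction n generalizing F with
  | zero => simp [coupledMean_zero]
  | succ n ih =>
    have hU : (uniformRate M : ℝ≥0∞) ≠ 0 := by exact_mod_cast uniformRate_pos.ne'
    rw [← ENNReal.mul_right_inj hU ENNReal.coe_ne_top, uniformRate_mul_coupledMean_succ]
    set q : ℕ × ℕ → ℝ≥0 := CTMC.exitRate (countRates M π) with hq
    have hqU : ∀ s, q s ≤ uniformRate M := fun s =>
      (exitRate_countRates_le s).trans (by
        unfold uniformRate
        gcongr
        rw [two_mul]
        exact le_self_add)
    have h : CTMC.flow (coupledRates π)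
        (fun z => F (z.1 + (z.2.1 + z.2.2.1), z.2.2.2.1 + (z.2.2.2.2.1 + z.2.2.2.2.2))) =
        fun z => (fun s => CTMC.flow (countRates M π) F s + (uniformRate M - q s : ℝ≥0) * F s)
          (z.1 + (z.2.1 + z.2.2.1), z.2.2.2.1 + (z.2.2.2.2.1 + z.2.2.2.2.2)) := by
      funext z
      obtain ⟨o, c, d, o', c', d'⟩ := z
      rw [flow_coupledRates_left (fun o m o' m' => F (o + m, o' + m'))]
      simp only [hq, CTMC.flow, countRates, List.map_cons, List.map_nil, List.sum_cons,
        List.sum_nil, (servers_eq o c d o' c' d').1, (servers_eq o c d o' c' d').2,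
        ENNReal.coe_mul, ENNReal.coe_add]
      have e1 : (oldI π (o, c, d, o', c', d') : ℝ≥0∞) * F (o - 1 + (c + d), o' + (c' + d')) =
          oldI π (o, c, d, o', c', d') * F (o + (c + d) - 1, o' + (c' + d')) := by
        rcases o with _ | o
        · simp [oldI]
        · rw [show o + 1 - 1 + (c + d) = o + 1 + (c + d) - 1 by omega]
      have e2 : (newI π (o, c, d, o', c', d') : ℝ≥0∞) * F (o + (c + d - 1), o' + (c' + d')) =
          newI π (o, c, d, o', c', d') * F (o + (c + d) - 1, o' + (c' + d')) := by
        rcases Nat.eq_zero_or_pos (c + d) with h | h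
        · simp [newI, h]
        · rw [show o + (c + d - 1) = o + (c + d) - 1 by omega]
      have e3 : (oldE π (o, c, d, o', c', d') : ℝ≥0∞) * F (o + (c + d), o' - 1 + (c' + d')) =
          oldE π (o, c, d, o', c', d') * F (o + (c + d), o' + (c' + d') - 1) := by
        rcases o' with _ | o'
        · simp [oldE]
        · rw [show o' + 1 - 1 + (c' + d') = o' + 1 + (c' + d') - 1 by omega]
      have e4 : (newE π (o, c, d, o', c', d') : ℝ≥0∞) * F (o + (c + d), o' + (c' + d' - 1)) =
          newE π (o, c, d, o', c', d') * F (o + (c + d), o' + (c' + d') - 1) := by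
        rcases Nat.eq_zero_or_pos (c' + d') with h | h
        · simp [newE, h]
        · rw [show o' + (c' + d' - 1) = o' + (c' + d') - 1 by omega]
      rw [e1, e2, e3, e4, ← add_assoc o, ← add_assoc o']
      simp only [add_mul, mul_add, mul_assoc]
      ring_nf
    rw [h]
    refine (ih fun s => CTMC.flow (countRates M π) F s + (uniformRate M - q s : ℝ≥0) * F s).trans ?_
    simp only [mul_add]
    rw [ENNReal.tsum_add, hν.tsum_flow, ← ENNReal.tsum_add, ← ENNReal.tsum_mul_left]
    refine tsum_congr fun s => ?_
    rw [← mul_add, ← add_mul, ← ENNReal.coe_add, add_tsub_cancel_of_le (hqU s), mul_left_comm]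

/-- The mean sum of the remaining times in the system of all new jobs grows by the mean response
time of the arriving jobs, and decreases by the mean number of new jobs. -/
theorem coupledMean_jobSum_succ (hν : CTMC.IsStationary (countRates M π) ν) (n : ℕ) :
    uniformRate M * coupledMean π ν (n + 1) (fun z =>
        jobSum (CTMC.meanTime (taggedRates M π) .done) z.1 (z.2.1 + z.2.2.1) z.2.2.2.1
          (z.2.2.2.2.1 + z.2.2.2.2.2)) +
      coupledMean π ν n (fun z => ((z.2.1 + z.2.2.1 + (z.2.2.2.2.1 + z.2.2.2.2.2) : ℕ) : ℝ≥0∞)) =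
    uniformRate M * coupledMean π ν n (fun z =>
        jobSum (CTMC.meanTime (taggedRates M π) .done) z.1 (z.2.1 + z.2.2.1) z.2.2.2.1
          (z.2.2.2.2.1 + z.2.2.2.2.2)) +
      ∑' s, ν s * arrivalReward M (CTMC.meanTime (taggedRates M π) .done) s := by
  set h := CTMC.meanTime (taggedRates M π) .done with hh
  rw [uniformRate_mul_coupledMean_succ, ← coupledMean_left hν n, ← coupledMean_const_mul,
    ← coupledMean_add, ← coupledMean_add]
  congr 1
  funext z
  obtain ⟨o, c, d, o', c', d'⟩ := z
  rw [flow_coupledRates_left (jobSum h)]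
  have h1 := jobSum_flow (M := M) (π := π) (h := h) meanTime_done o (c + d) o' (c' + d')
  have h2 := exitRate_mul_jobSum (M := M) (π := π) (f := h) (g := h)
    (fun x hx => CTMC.exitRate_mul_meanTime hx (exitRate_taggedRates_ne_zero hx))
    o (c + d) o' (c' + d')
  simp only [oldI, newI, oldE, newE]
  rw [← h1]
  set q := CTMC.exitRate (countRates M π) (o + (c + d), o' + (c' + d')) with hq
  have hU : (uniformRate M : ℝ≥0∞) = q + (uniformRate M - q : ℝ≥0) := by
    rw [← ENNReal.coe_add, add_tsub_cancel_of_le]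
    refine (exitRate_countRates_le _).trans ?_
    unfold uniformRate
    gcongr
    rw [two_mul]
    exact le_self_add
  rw [hU, add_mul, h2]
  ring

/-- On average over time, the work-conserving system has at most as many jobs as the system under
`π` has new jobs, and hence at most as many as Little's law gives for the jobs that eventually
complete. -/
theorem sum_coupledMean_card_le (hν : CTMC.IsStationary (countRates M π) ν) (N : ℕ) :
    ∑ n ∈ Finset.range N,
        coupledMean π ν n (fun z => ((z.2.1 + z.2.2.2.2.1 : ℕ) : ℝ≥0∞)) ≤
      N * (((M.lamI + M.lamE : ℝ≥0) : ℝ≥0∞) *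
        ∫⁻ ω, responseTime M π ω ∂CTMC.pathMeasure (taggedRates M π) (arrivalLaw M ν)) := by
  unfold responseTime
  rw [CTMC.lintegral_absorptionTime, lintegral_arrivalLaw]
  set h := CTMC.meanTime (taggedRates M π) .done with hh
  set W : ℕ → ℝ≥0∞ := fun n => coupledMean π ν n (fun z =>
    jobSum h z.1 (z.2.1 + z.2.2.1) z.2.2.2.1 (z.2.2.2.2.1 + z.2.2.2.2.2)) with hW
  have key : ∀ N : ℕ, uniformRate M * W N + ∑ n ∈ Finset.range N, coupledMean π ν n
      (fun z => ((z.2.1 + z.2.2.1 + (z.2.2.2.2.1 + z.2.2.2.2.2) : ℕ) : ℝ≥0∞)) =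
      N * ∑' s, ν s * arrivalReward M h s := by
    intro N
    induction N with
    | zero => simp [hW, coupledMean_zero, jobSum, sumI, sumE]
    | succ N ih =>
      have hs := coupledMean_jobSum_succ hν N
      rw [← hh] at hs
      rw [Finset.sum_range_succ, add_comm (∑ n ∈ Finset.range N, _), ← add_assoc, hs,
        add_right_comm, ih]
      push_cast
      ring
  rw [← key N]
  refine le_trans ?_ le_add_self
  refine Finset.sum_le_sum fun n _ => coupledMean_mono n fun z => ?_
  exact_mod_cast (by omega : z.2.1 + z.2.2.2.2.1 ≤ z.2.1 + z.2.2.1 + (z.2.2.2.2.1 + z.2.2.2.2.2))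

/-- `a` is a measure on the states and `u`, `v` are the mean numbers of servers for inelastic and
elastic jobs (weighted by `a`) under a randomized work-conserving allocation. -/
structure IsAllocation (k : ℕ) (a u v : ℕ × ℕ → ℝ≥0∞) : Prop where
  le : ∀ s, u s ≤ s.1 * a s
  add_eq : ∀ s : ℕ × ℕ, 0 < s.2 → u s + v s = k * a s
  elastic_eq : ∀ s : ℕ × ℕ, s.2 = 0 → v s = 0
  inelastic_eq : ∀ s : ℕ × ℕ, s.2 = 0 → u s = (min (s.1 : ℝ≥0) k : ℝ≥0) * a s

/-- The flow into the state `s`. -/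
noncomputable def inflow (M : Model) (a u v : ℕ × ℕ → ℝ≥0∞) (s : ℕ × ℕ) : ℝ≥0∞ :=
  M.lamI * (if s.1 = 0 then 0 else a (s.1 - 1, s.2)) +
    M.lamE * (if s.2 = 0 then 0 else a (s.1, s.2 - 1)) +
    M.muI * u (s.1 + 1, s.2) + M.muE * v (s.1, s.2 + 1)

/-- The flow out of the state `s`. -/
noncomputable def outflow (M : Model) (a u v : ℕ × ℕ → ℝ≥0∞) (s : ℕ × ℕ) : ℝ≥0∞ :=
  (M.lamI + M.lamE) * a s + M.muI * u s + M.muE * v s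

/-- The indicator of the coupled states in which the work-conserving system is in state `s`. -/
noncomputable def atState (s : ℕ × ℕ) (z : Coupled) : ℝ≥0∞ :=
  if (z.2.1, z.2.2.2.2.1) = s then 1 else 0

theorem coupledMean_zero_fun (n : ℕ) : coupledMean π ν n (fun _ => 0) = 0 := by
  simp [coupledMean]

theorem isAllocation_coupledMean (n : ℕ) :
    IsAllocation M.k (fun s => coupledMean π ν n (atState s))
      (fun s => coupledMean π ν n (fun z => wcI π z * atState s z))
      (fun s => coupledMean π ν n (fun z => wcE π z * atState s z)) where
  le s := by
    rw [← coupledMean_const_mul]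
    refine coupledMean_mono n fun z => ?_
    unfold atState
    split_ifs with h
    · subst h
      simpa using ENNReal.coe_le_coe.2 (wcI_le z)
    · simp
  add_eq s hs := by
    rw [← coupledMean_const_mul, ← coupledMean_add]
    congr 1
    funext z
    unfold atState
    split_ifs with h
    · subst h
      simp only [mul_one, ← ENNReal.coe_add, wcI_add_wcE_of_pos hs]
      simp
    · simp
  elastic_eq s hs := by
    refine Eq.trans ?_ (coupledMean_zero_fun (π := π) (ν := ν) n)
    congr 1
    funext z
    unfold atState
    split_ifs with h
    · subst h
      simp [wcE_of_eq_zero hs]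
    · simp
  inelastic_eq s hs := by
    rw [← coupledMean_const_mul]
    congr 1
    funext z
    unfold atState
    split_ifs with h
    · subst h
      simp only [wcI_of_eq_zero hs]
    · simp

theorem coupledMean_balance (n : ℕ) (s : ℕ × ℕ) :
    uniformRate M * coupledMean π ν (n + 1) (atState s) +
      outflow M (fun s => coupledMean π ν n (atState s))
        (fun s => coupledMean π ν n (fun z => wcI π z * atState s z))
        (fun s => coupledMean π ν n (fun z => wcE π z * atState s z)) s =
    inflow M (fun s => coupledMean π ν n (atState s))
        (fun s => coupledMean π ν n (fun z => wcI π z * atState s z))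
        (fun s => coupledMean π ν n (fun z => wcE π z * atState s z)) s +
      uniformRate M * coupledMean π ν n (atState s) := by
  have h1 : (if s.1 = 0 then 0 else coupledMean π ν n (atState (s.1 - 1, s.2))) =
      coupledMean π ν n (fun z => if (z.2.1 + 1, z.2.2.2.2.1) = s then 1 else 0) := by
    split_ifs with hs
    · refine (coupledMean_zero_fun (π := π) (ν := ν) n).symm.trans ?_
      congr 1
      funext z
      rw [if_neg]
      rintro rfl
      simp at hs
    · congr 1
      funext z
      unfold atState
      congr 1
      simp only [Prod.ext_iff, eq_iff_iff]
      omega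
  have h2 : (if s.2 = 0 then 0 else coupledMean π ν n (atState (s.1, s.2 - 1))) =
      coupledMean π ν n (fun z => if (z.2.1, z.2.2.2.2.1 + 1) = s then 1 else 0) := by
    split_ifs with hs
    · refine (coupledMean_zero_fun (π := π) (ν := ν) n).symm.trans ?_
      congr 1
      funext z
      rw [if_neg]
      rintro rfl
      simp at hs
    · congr 1
      funext z
      unfold atState
      congr 1
      simp only [Prod.ext_iff, eq_iff_iff]
      omega
  have h3 : ∀ z : Coupled, (wcI π z : ℝ≥0∞) * atState (s.1 + 1, s.2) z =
      wcI π z * (if (z.2.1 - 1, z.2.2.2.2.1) = s then 1 else 0) := by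
    intro z
    rcases Nat.eq_zero_or_pos z.2.1 with h | h
    · have : wcI π z = 0 := by simpa [h] using wcI_le (π := π) z
      simp [this]
    · unfold atState
      congr 2
      simp only [Prod.ext_iff, eq_iff_iff]
      omega
  have h4 : ∀ z : Coupled, (wcE π z : ℝ≥0∞) * atState (s.1, s.2 + 1) z =
      wcE π z * (if (z.2.1, z.2.2.2.2.1 - 1) = s then 1 else 0) := by
    intro z
    rcases Nat.eq_zero_or_pos z.2.2.2.2.1 with h | h
    · simp [wcE_of_eq_zero h]
    · unfold atState
      congr 2
      simp only [Prod.ext_iff, eq_iff_iff]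
      omega
  simp only [inflow, outflow]
  rw [uniformRate_mul_coupledMean_succ, h1, h2]
  simp only [h3, h4, ← coupledMean_const_mul, ← coupledMean_add]
  congr 1
  funext z
  have := flow_coupledRates_right (π := π) (fun t => if t = s then 1 else 0) z
  unfold atState
  rw [← this]
  ring

/-- Every policy with a stationary distribution gives rise to randomized work-conserving
allocations that are nearly in balance and have no more jobs: the averages over the first `N`
transitions of the coupled systems. -/
theorem exists_isAllocation_nearly_balanced (hν : CTMC.IsStationary (countRates M π) ν) {N : ℕ}
    (hN : N ≠ 0) :
    ∃ a u v : ℕ × ℕ → ℝ≥0∞, IsAllocation M.k a u v ∧ ∑' s, a s = 1 ∧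
      ∑' s, a s * ((s.1 + s.2 : ℕ) : ℝ≥0∞) ≤ ((M.lamI + M.lamE : ℝ≥0) : ℝ≥0∞) *
        ∫⁻ ω, responseTime M π ω ∂CTMC.pathMeasure (taggedRates M π) (arrivalLaw M ν) ∧
      ∀ s, inflow M a u v s ≤ outflow M a u v s + (N : ℝ≥0∞)⁻¹ * uniformRate M ∧
        outflow M a u v s ≤ inflow M a u v s + (N : ℝ≥0∞)⁻¹ * uniformRate M := by
  set A : ℕ → ℕ × ℕ → ℝ≥0∞ := fun n s => coupledMean π ν n (atState s) with hA
  set X : ℕ → ℕ × ℕ → ℝ≥0∞ := fun n s => coupledMean π ν n (fun z => wcI π z * atState s z)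
    with hX
  set Y : ℕ → ℕ × ℕ → ℝ≥0∞ := fun n s => coupledMean π ν n (fun z => wcE π z * atState s z)
    with hY
  have hAX : ∀ n, IsAllocation M.k (A n) (X n) (Y n) := fun n => isAllocation_coupledMean n
  have hA1 : ∀ n, ∑' s, A n s = 1 := by
    intro n
    rw [← coupledMean_tsum, ← coupledMean_one (π := π) (ν := ν) n]
    congr 1
    funext z
    simp [atState]
  have hN0 : (N : ℝ≥0∞) ≠ 0 := by exact_mod_cast hN
  have hNt : (N : ℝ≥0∞) ≠ ∞ := ENNReal.natCast_ne_top N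
  set r : ℝ≥0∞ := (N : ℝ≥0∞)⁻¹ with hr
  have hrN : r * N = 1 := ENNReal.inv_mul_cancel hN0 hNt
  refine ⟨fun s => r * ∑ n ∈ Finset.range N, A n s, fun s => r * ∑ n ∈ Finset.range N, X n s,
    fun s => r * ∑ n ∈ Finset.range N, Y n s, ⟨?_, ?_, ?_, ?_⟩, ?_, ?_, ?_⟩
  · intro s
    rw [mul_left_comm, Finset.mul_sum _ _ (s.1 : ℝ≥0∞)]
    gcongr with n
    exact (hAX n).le s
  · intro s hs
    rw [mul_left_comm, Finset.mul_sum _ _ (M.k : ℝ≥0∞), ← mul_add, ← Finset.sum_add_distrib]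
    congr 1
    exact Finset.sum_congr rfl fun n _ => (hAX n).add_eq s hs
  · intro s hs
    rw [Finset.sum_eq_zero fun n _ => (hAX n).elastic_eq s hs, mul_zero]
  · intro s hs
    rw [mul_left_comm, Finset.mul_sum _ _ ((min (s.1 : ℝ≥0) M.k : ℝ≥0) : ℝ≥0∞)]
    congr 1
    exact Finset.sum_congr rfl fun n _ => (hAX n).inelastic_eq s hs
  · rw [ENNReal.tsum_mul_left, Summable.tsum_finsetSum fun _ _ => ENNReal.summable]
    simp [hA1, hrN]
  · have h1 : ∀ n, ∑' s : ℕ × ℕ, A n s * ((s.1 + s.2 : ℕ) : ℝ≥0∞) =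
        coupledMean π ν n (fun z => ((z.2.1 + z.2.2.2.2.1 : ℕ) : ℝ≥0∞)) := by
      intro n
      simp_rw [hA, mul_comm (coupledMean π ν n _), ← coupledMean_const_mul]
      rw [← coupledMean_tsum]
      congr 1
      funext z
      rw [tsum_eq_single (z.2.1, z.2.2.2.2.1)]
      · simp [atState]
      · intro s hs
        simp [atState, hs.symm]
    have h2 := sum_coupledMean_card_le hν N
    simp_rw [← h1] at h2
    rw [← Summable.tsum_finsetSum fun _ _ => ENNReal.summable] at h2
    simp_rw [mul_assoc, ENNReal.tsum_mul_left, Finset.sum_mul]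
    refine (mul_le_mul_right h2 r).trans ?_
    rw [← mul_assoc, hrN, one_mul]
  · intro s
    have hin : inflow M (fun s => r * ∑ n ∈ Finset.range N, A n s)
        (fun s => r * ∑ n ∈ Finset.range N, X n s) (fun s => r * ∑ n ∈ Finset.range N, Y n s) s =
        r * ∑ n ∈ Finset.range N, inflow M (A n) (X n) (Y n) s := by
      simp only [inflow, Finset.sum_add_distrib, ← Finset.mul_sum]
      split_ifs <;> first | ring1 | (simp only [Finset.sum_const_zero]; ring)
    have hout : outflow M (fun s => r * ∑ n ∈ Finset.range N, A n s)
        (fun s => r * ∑ n ∈ Finset.range N, X n s) (fun s => r * ∑ n ∈ Finset.range N, Y n s) s =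
        r * ∑ n ∈ Finset.range N, outflow M (A n) (X n) (Y n) s := by
      simp only [outflow, Finset.sum_add_distrib, ← Finset.mul_sum]
      ring
    have hA_le : ∀ n, A n s ≤ 1 := fun n => (hA1 n) ▸ ENNReal.le_tsum s
    have hsum := Finset.sum_congr rfl fun n (_ : n ∈ Finset.range N) =>
      coupledMean_balance (π := π) (ν := ν) n s
    simp only [Finset.sum_add_distrib, ← Finset.mul_sum] at hsum
    have hfin : uniformRate M * ∑ n ∈ Finset.range N, A n s ≠ ∞ :=
      ENNReal.mul_ne_top ENNReal.coe_ne_top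
        (ENNReal.sum_ne_top.2 fun n _ => ne_top_of_le_ne_top ENNReal.one_ne_top (hA_le n))
    have htel : ∑ n ∈ Finset.range N, A (n + 1) s + A 0 s =
        ∑ n ∈ Finset.range N, A n s + A N s := by
      rw [← Finset.sum_range_succ' (fun n => A n s), Finset.sum_range_succ]
    have hbal : ∑ n ∈ Finset.range N, outflow M (A n) (X n) (Y n) s + uniformRate M * A N s =
        ∑ n ∈ Finset.range N, inflow M (A n) (X n) (Y n) s + uniformRate M * A 0 s := by
      refine (ENNReal.add_right_inj hfin).1 ?_
      calc _ = uniformRate M * (∑ n ∈ Finset.range N, A n s + A N s) +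
            ∑ n ∈ Finset.range N, outflow M (A n) (X n) (Y n) s := by ring
        _ = (uniformRate M * ∑ n ∈ Finset.range N, A (n + 1) s +
            ∑ n ∈ Finset.range N, outflow M (A n) (X n) (Y n) s) + uniformRate M * A 0 s := by
          rw [← htel]; ring
        _ = _ := by rw [hsum]; ring
    have hU : ∀ n, uniformRate M * A n s ≤ uniformRate M := fun n =>
      (mul_le_mul_right (hA_le n) _).trans (mul_one _).le
    rw [hin, hout, ← mul_add, ← mul_add]
    constructor
    · refine mul_le_mul_right ?_ _
      exact (le_self_add.trans hbal.ge).trans (add_le_add le_rfl (hU N))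
    · refine mul_le_mul_right ?_ _
      exact (le_self_add.trans hbal.le).trans (add_le_add le_rfl (hU 0))

end ElasticQueue

/-! ### The optimal allocation as a limit -/

namespace ElasticQueue

open Filter Topology

/-- Nearly balanced work-conserving allocations with bounded mean numbers of jobs have a balanced
limit: the bound keeps the total mass from escaping to infinity. -/
theorem exists_balanced_isAllocation (M : Model) {a u v : ℕ → ℕ × ℕ → ℝ≥0∞} {C δ : ℕ → ℝ≥0∞}
    {c : ℝ≥0∞} (hc : c ≠ ∞) (h : ∀ n, IsAllocation M.k (a n) (u n) (v n))
    (h1 : ∀ n, ∑' s, a n s = 1)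
    (hC : ∀ n, ∑' s, a n s * ((s.1 + s.2 : ℕ) : ℝ≥0∞) ≤ C n) (hCc : Tendsto C atTop (𝓝 c))
    (hδ : Tendsto δ atTop (𝓝 0))
    (hin : ∀ n s, inflow M (a n) (u n) (v n) s ≤ outflow M (a n) (u n) (v n) s + δ n)
    (hout : ∀ n s, outflow M (a n) (u n) (v n) s ≤ inflow M (a n) (u n) (v n) s + δ n) :
    ∃ a' u' v' : ℕ × ℕ → ℝ≥0∞, IsAllocation M.k a' u' v' ∧ ∑' s, a' s = 1 ∧
      ∑' s, a' s * ((s.1 + s.2 : ℕ) : ℝ≥0∞) ≤ c ∧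
      ∀ s, inflow M a' u' v' s = outflow M a' u' v' s := by
  -- All limits exist along an ultrafilter, because `ℝ≥0∞` is compact.
  set F : Ultrafilter ℕ := hyperfilter ℕ with hF
  have hFle : (F : Filter ℕ) ≤ atTop := by
    rw [← Nat.cofinite_eq_atTop]; exact hyperfilter_le_cofinite
  have hlim : ∀ x : ℕ → ℕ × ℕ → ℝ≥0∞, ∃ l : ℕ × ℕ → ℝ≥0∞, ∀ s,
      Tendsto (fun n => x n s) F (𝓝 (l s)) := fun x =>
    ⟨fun s => (F.map fun n => x n s).lim, fun s => (F.map fun n => x n s).le_nhds_lim⟩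
  obtain ⟨a', ha⟩ := hlim a
  obtain ⟨u', hu⟩ := hlim u
  obtain ⟨v', hv⟩ := hlim v
  have cmul : ∀ {x : ℕ → ℝ≥0∞} {l : ℝ≥0∞} (r : ℝ≥0∞), r ≠ ∞ → Tendsto x F (𝓝 l) →
      Tendsto (fun n => r * x n) F (𝓝 (r * l)) := fun r hr hx =>
    ENNReal.Tendsto.const_mul hx (Or.inr hr)
  have hinl : ∀ s, Tendsto (fun n => inflow M (a n) (u n) (v n) s) F
      (𝓝 (inflow M a' u' v' s)) := by
    intro s
    unfold inflow
    refine (((cmul _ ENNReal.coe_ne_top ?_).add (cmul _ ENNReal.coe_ne_top ?_)).add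
      (cmul _ ENNReal.coe_ne_top (hu _))).add (cmul _ ENNReal.coe_ne_top (hv _))
    · split_ifs
      · exact tendsto_const_nhds
      · exact ha _
    · split_ifs
      · exact tendsto_const_nhds
      · exact ha _
  have houtl : ∀ s, Tendsto (fun n => outflow M (a n) (u n) (v n) s) F
      (𝓝 (outflow M a' u' v' s)) := fun s =>
    ((cmul _ (ENNReal.add_ne_top.2 ⟨ENNReal.coe_ne_top, ENNReal.coe_ne_top⟩) (ha s)).add
      (cmul _ ENNReal.coe_ne_top (hu s))).add (cmul _ ENNReal.coe_ne_top (hv s))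
  have hCF := hCc.mono_left hFle
  have hδF := hδ.mono_left hFle
  have hcost : ∀ T : Finset (ℕ × ℕ), ∑ s ∈ T, a' s * ((s.1 + s.2 : ℕ) : ℝ≥0∞) ≤ c := by
    intro T
    refine le_of_tendsto_of_tendsto' (tendsto_finsetSum T fun s _ => ?_) hCF
      (fun n => (ENNReal.sum_le_tsum T).trans (hC n))
    exact ENNReal.Tendsto.mul_const (ha s) (Or.inr (ENNReal.natCast_ne_top _))
  refine ⟨a', u', v', ⟨fun s => ?_, fun s hs => ?_, fun s hs => ?_, fun s hs => ?_⟩, ?_, ?_, ?_⟩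
  · exact le_of_tendsto_of_tendsto' (hu s) (cmul _ (ENNReal.natCast_ne_top _) (ha s))
      (fun n => (h n).le s)
  · refine tendsto_nhds_unique ((hu s).add (hv s)) ?_
    simp_rw [fun n => (h n).add_eq s hs]
    exact cmul _ (ENNReal.natCast_ne_top _) (ha s)
  · refine tendsto_nhds_unique (hv s) ?_
    simp_rw [fun n => (h n).elastic_eq s hs]
    exact tendsto_const_nhds
  · refine tendsto_nhds_unique (hu s) ?_
    simp_rw [fun n => (h n).inelastic_eq s hs]
    exact cmul _ ENNReal.coe_ne_top (ha s)
  · apply le_antisymm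
    · rw [ENNReal.tsum_eq_iSup_sum]
      refine iSup_le fun T => ?_
      exact le_of_tendsto' (tendsto_finsetSum T fun s _ => ha s)
        (fun n => (ENNReal.sum_le_tsum T).trans (h1 n).le)
    · -- By Markov's inequality, mass at most `c / R` lies outside of a finite box.
      have hR : ∀ R : ℕ, R ≠ 0 → (1 : ℝ≥0∞) ≤ ∑' s, a' s + c * (R : ℝ≥0∞)⁻¹ := by
        intro R hR
        set T : Finset (ℕ × ℕ) := Finset.range R ×ˢ Finset.range R with hT
        have hR0 : (R : ℝ≥0∞) ≠ 0 := by exact_mod_cast hR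
        have hRt : (R : ℝ≥0∞) ≠ ∞ := ENNReal.natCast_ne_top R
        have hn : ∀ n, (R : ℝ≥0∞) ≤ R * ∑ s ∈ T, a n s + C n := by
          intro n
          calc (R : ℝ≥0∞) = ∑' s, R * a n s := by rw [ENNReal.tsum_mul_left, h1, mul_one]
            _ ≤ ∑' s, (R * (if s ∈ T then a n s else 0) +
                a n s * ((s.1 + s.2 : ℕ) : ℝ≥0∞)) := by
              refine ENNReal.tsum_le_tsum fun s => ?_
              split_ifs with hs
              · exact le_self_add
              · rw [mul_zero, zero_add, mul_comm]
                gcongr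
                simp only [hT, Finset.mem_product, Finset.mem_range] at hs
                omega
            _ ≤ R * ∑ s ∈ T, a n s + C n := by
              rw [ENNReal.tsum_add, ENNReal.tsum_mul_left]
              refine add_le_add (le_of_eq ?_) (hC n)
              rw [tsum_eq_sum (s := T) (fun s hs => if_neg hs)]
              congr 1
              exact Finset.sum_congr rfl fun s hs => if_pos hs
        have hl : (R : ℝ≥0∞) ≤ R * ∑ s ∈ T, a' s + c :=
          le_of_tendsto_of_tendsto' tendsto_const_nhds
            ((cmul _ hRt (tendsto_finsetSum T fun s _ => ha s)).add hCF) hn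
        calc (1 : ℝ≥0∞) = R * (R : ℝ≥0∞)⁻¹ := (ENNReal.mul_inv_cancel hR0 hRt).symm
          _ ≤ (R * ∑' s, a' s + c) * (R : ℝ≥0∞)⁻¹ := by
            gcongr
            exact hl.trans (add_le_add (mul_le_mul_right (ENNReal.sum_le_tsum T) _) le_rfl)
          _ = _ := by
            rw [add_mul, mul_right_comm, ENNReal.mul_inv_cancel hR0 hRt, one_mul]
      have ht : Tendsto (fun R : ℕ => ∑' s, a' s + c * (R : ℝ≥0∞)⁻¹) atTop
          (𝓝 (∑' s, a' s + c * 0)) :=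
        tendsto_const_nhds.add
          (ENNReal.Tendsto.const_mul ENNReal.tendsto_inv_nat_nhds_zero (Or.inr hc))
      rw [mul_zero, add_zero] at ht
      exact ge_of_tendsto ht ((eventually_ne_atTop 0).mono hR)
  · rw [ENNReal.tsum_eq_iSup_sum]
    exact iSup_le hcost
  · intro s
    apply le_antisymm
    · have := le_of_tendsto_of_tendsto' (hinl s) ((houtl s).add hδF) (fun n => hin n s)
      rwa [add_zero] at this
    · have := le_of_tendsto_of_tendsto' (houtl s) ((hinl s).add hδF) (fun n => hout n s)
      rwa [add_zero] at this

/-! ### From allocations to policies -/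

/-- The policy that divides `x i j` servers equally among the inelastic jobs and `y i j` servers
equally among the elastic jobs. -/
noncomputable def evenPolicy {k : ℕ} (x y : ℕ → ℕ → ℝ≥0) (hx : ∀ i j, x i j ≤ i)
    (hxy : ∀ i j, x i j + y i j ≤ k) : Policy k where
  allocI i j _ := x i j / i
  allocE i j _ := y i j / j
  allocI_le_one i j p hp := by
    rw [div_le_one (by exact_mod_cast (by omega : 0 < i))]
    exact hx i j
  total_le i j := by
    have aux : ∀ (n : ℕ) (r : ℝ≥0), ∑ _p ∈ Finset.range n, r / n ≤ r := by
      intro n r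
      rw [Finset.sum_const, Finset.card_range, nsmul_eq_mul]
      rcases Nat.eq_zero_or_pos n with rfl | hn
      · simp
      · exact (mul_div_cancel₀ _ (by exact_mod_cast hn.ne')).le
    exact (add_le_add (aux i _) (aux j _)).trans (hxy i j)

theorem serversI_evenPolicy {k : ℕ} {x y : ℕ → ℕ → ℝ≥0} (hx : ∀ i j, x i j ≤ i)
    (hxy : ∀ i j, x i j + y i j ≤ k) (i j : ℕ) :
    (evenPolicy x y hx hxy).serversI i j = x i j := by
  simp only [Policy.serversI, evenPolicy, Finset.sum_const, Finset.card_range, nsmul_eq_mul]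
  rcases Nat.eq_zero_or_pos i with rfl | hi
  · have := hx 0 j
    simp_all
  · exact mul_div_cancel₀ _ (by exact_mod_cast hi.ne')

theorem serversE_evenPolicy {k : ℕ} {x y : ℕ → ℕ → ℝ≥0} (hx : ∀ i j, x i j ≤ i)
    (hxy : ∀ i j, x i j + y i j ≤ k) (hy : ∀ i, y i 0 = 0) (i j : ℕ) :
    (evenPolicy x y hx hxy).serversE i j = y i j := by
  simp only [Policy.serversE, evenPolicy, Finset.sum_const, Finset.card_range, nsmul_eq_mul]
  rcases Nat.eq_zero_or_pos j with rfl | hj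
  · simp [hy]
  · exact mul_div_cancel₀ _ (by exact_mod_cast hj.ne')

/-- Any work-conserving numbers of servers in the states are attained by some policy. -/
theorem exists_workConserving {k : ℕ} (x y : ℕ → ℕ → ℝ≥0) (hx : ∀ i j, x i j ≤ i)
    (hxy : ∀ i j, 0 < j → x i j + y i j = k) (hx0 : ∀ i, x i 0 = min (i : ℝ≥0) k)
    (hy0 : ∀ i, y i 0 = 0) :
    ∃ π : Policy k, π.WorkConserving ∧ (∀ i j, π.serversI i j = x i j) ∧
      ∀ i j, π.serversE i j = y i j := by
  have hle : ∀ i j, x i j + y i j ≤ k := by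
    intro i j
    rcases Nat.eq_zero_or_pos j with rfl | hj
    · rw [hx0, hy0, add_zero]; exact min_le_right _ _
    · exact (hxy i j hj).le
  have hI := serversI_evenPolicy hx hle
  have hE := serversE_evenPolicy hx hle hy0
  refine ⟨evenPolicy x y hx hle, fun i j => ?_, hI, hE⟩
  rw [hI, hE]
  refine ⟨?_, hxy i j⟩
  rcases Nat.eq_zero_or_pos j with rfl | hj
  · rw [hx0, hy0, add_zero]
  · rw [hxy i j hj]; exact min_le_right _ _

/-- A balanced work-conserving allocation is realized by a work-conserving policy with the given
stationary distribution. Randomization is not needed, because fractions of servers can be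
allocated. -/
theorem exists_workConserving_isStationary (M : Model) {a u v : ℕ × ℕ → ℝ≥0∞}
    (h : IsAllocation M.k a u v) (h1 : ∑' s, a s = 1)
    (hbal : ∀ s, inflow M a u v s = outflow M a u v s) :
    ∃ (π : Policy M.k) (ν : PMF (ℕ × ℕ)), π.WorkConserving ∧
      CTMC.IsStationary (countRates M π) ν ∧ ∀ s, ν s = a s := by
  have ha : ∀ s, a s ≠ ∞ := fun s =>
    ne_top_of_le_ne_top ENNReal.one_ne_top (h1 ▸ ENNReal.le_tsum s)
  have hu : ∀ s, u s ≠ ∞ := fun s =>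
    ne_top_of_le_ne_top (ENNReal.mul_ne_top (ENNReal.natCast_ne_top _) (ha s)) (h.le s)
  have hu0 : ∀ s, a s = 0 → u s = 0 := fun s hs => by simpa [hs] using h.le s
  have huk : ∀ s, u s ≤ M.k * a s := by
    intro s
    rcases Nat.eq_zero_or_pos s.2 with hs | hs
    · rw [h.inelastic_eq s hs]
      gcongr
      exact_mod_cast (min_le_right _ _ : min (s.1 : ℝ≥0) M.k ≤ M.k)
    · exact le_self_add.trans (h.add_eq s hs).le
  -- In the states of probability `0`, the inelastic jobs may take all servers that they can use.
  set x : ℕ → ℕ → ℝ≥0 := fun i j =>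
    if a (i, j) = 0 then min (i : ℝ≥0) M.k else (u (i, j) / a (i, j)).toNNReal with hxdef
  set y : ℕ → ℕ → ℝ≥0 := fun i j => if j = 0 then 0 else M.k - x i j with hydef
  have hxa : ∀ i j, (x i j : ℝ≥0∞) * a (i, j) = u (i, j) := by
    intro i j
    simp only [hxdef]
    split_ifs with h0
    · rw [hu0 _ h0, h0, mul_zero]
    · rw [ENNReal.coe_toNNReal (ENNReal.div_ne_top (hu _) h0), ENNReal.div_mul_cancel h0 (ha _)]
  have hx : ∀ i j, x i j ≤ min (i : ℝ≥0) M.k := by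
    intro i j
    by_cases h0 : a (i, j) = 0
    · simp [hxdef, h0]
    · have e : ∀ r : ℝ≥0, u (i, j) ≤ r * a (i, j) → x i j ≤ r := by
        intro r hr
        rw [← hxa] at hr
        exact ENNReal.coe_le_coe.1 ((ENNReal.mul_le_mul_iff_left h0 (ha _)).1 hr)
      exact le_min (e _ (by simpa using h.le (i, j))) (e _ (by simpa using huk (i, j)))
  have hx0 : ∀ i, x i 0 = min (i : ℝ≥0) M.k := by
    intro i
    by_cases h0 : a (i, 0) = 0
    · simp [hxdef, h0]
    · have e := hxa i 0
      rw [h.inelastic_eq (i, 0) rfl] at e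
      exact ENNReal.coe_inj.1 ((ENNReal.mul_left_inj h0 (ha _)).1 e)
  have hxy : ∀ i j, 0 < j → x i j + y i j = M.k := by
    intro i j hj
    simp only [hydef, if_neg hj.ne']
    exact add_tsub_cancel_of_le ((hx i j).trans (min_le_right _ _))
  have hya : ∀ i j, (y i j : ℝ≥0∞) * a (i, j) = v (i, j) := by
    intro i j
    rcases Nat.eq_zero_or_pos j with rfl | hj
    · simp [hydef, h.elastic_eq (i, 0) rfl]
    · refine (ENNReal.add_right_inj (hu (i, j))).1 ?_
      rw [h.add_eq (i, j) hj, ← hxa, ← add_mul, ← ENNReal.coe_add, hxy i j hj]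
      simp
  obtain ⟨π, hπ, hI, hE⟩ := exists_workConserving x y
    (fun i j => (hx i j).trans (min_le_left _ _)) hxy hx0 (fun i => by simp [hydef])
  refine ⟨π, ⟨a, h1 ▸ ENNReal.summable.hasSum⟩, hπ, fun t => ?_, fun s => rfl⟩
  change ∑' s, a s * _ = a t * _
  have hrate : ∀ s, a s * (CTMC.rate (countRates M π) s t : ℝ≥0∞) =
      M.lamI * (if (s.1 + 1, s.2) = t then a s else 0) +
      M.lamE * (if (s.1, s.2 + 1) = t then a s else 0) +
      M.muI * (if (s.1 - 1, s.2) = t then u s else 0) +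
      M.muE * (if (s.1, s.2 - 1) = t then v s else 0) := by
    intro s
    simp only [CTMC.rate, countRates, List.map_cons, List.map_nil, List.sum_cons, List.sum_nil,
      hI, hE, ENNReal.coe_add, ← hxa s.1 s.2, ← hya s.1 s.2]
    push_cast
    split_ifs <;> push_cast <;> ring
  have t1 : ∑' s : ℕ × ℕ, (if (s.1 + 1, s.2) = t then a s else 0) =
      if t.1 = 0 then 0 else a (t.1 - 1, t.2) := by
    rw [tsum_eq_single (t.1 - 1, t.2)]
    · by_cases h0 : t.1 = 0
      · rw [if_pos h0, if_neg]; intro e; simpa [h0] using congrArg Prod.fst e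
      · rw [if_neg h0, if_pos]; ext <;> simp; omega
    · intro s hs
      rw [if_neg]; rintro rfl; simp at hs
  have t2 : ∑' s : ℕ × ℕ, (if (s.1, s.2 + 1) = t then a s else 0) =
      if t.2 = 0 then 0 else a (t.1, t.2 - 1) := by
    rw [tsum_eq_single (t.1, t.2 - 1)]
    · by_cases h0 : t.2 = 0
      · rw [if_pos h0, if_neg]; intro e; simpa [h0] using congrArg Prod.snd e
      · rw [if_neg h0, if_pos]; ext <;> simp; omega
    · intro s hs
      rw [if_neg]; rintro rfl; simp at hs
  have t3 : ∑' s : ℕ × ℕ, (if (s.1 - 1, s.2) = t then u s else 0) = u (t.1 + 1, t.2) := by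
    rw [tsum_eq_single (t.1 + 1, t.2)]
    · simp
    · intro s hs
      split_ifs with e
      · have h0 : s.1 = 0 := by
          by_contra h0
          apply hs
          rw [← e]
          ext <;> simp
          omega
        simpa [h0] using h.le s
      · rfl
  have t4 : ∑' s : ℕ × ℕ, (if (s.1, s.2 - 1) = t then v s else 0) = v (t.1, t.2 + 1) := by
    rw [tsum_eq_single (t.1, t.2 + 1)]
    · simp
    · intro s hs
      split_ifs with e
      · have h0 : s.2 = 0 := by
          by_contra h0
          apply hs
          rw [← e]
          ext <;> simp
          omega
        exact h.elastic_eq s h0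
      · rfl
  simp_rw [hrate]
  rw [ENNReal.tsum_add, ENNReal.tsum_add, ENNReal.tsum_add]
  simp only [ENNReal.tsum_mul_left]
  rw [t1, t2, t3, t4]
  refine (hbal t).trans ?_
  simp only [outflow, CTMC.exitRate, countRates, List.map_cons, List.map_nil, List.sum_cons,
    List.sum_nil, hI, hE, ← hxa t.1 t.2, ← hya t.1 t.2]
  push_cast
  ring

/-- A minimizing sequence of policies yields nearly balanced work-conserving allocations whose
limit is realized by a work-conserving policy. -/
theorem exists_workConserving_forall_le (M : Model) :
    ∃ πopt : Policy M.k, πopt.WorkConserving ∧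
      ∀ π : Policy M.k, meanResponseTime M πopt ≤ meanResponseTime M π := by
  set m : ℝ≥0∞ := ⨅ π : Policy M.k, meanResponseTime M π with hm
  rcases eq_or_ne m ∞ with hm0 | hm0
  · -- No policy has a finite mean response time.
    obtain ⟨π, hπ, -⟩ := exists_workConserving (k := M.k) (fun i _ => min (i : ℝ≥0) M.k)
      (fun i j => if j = 0 then 0 else M.k - min (i : ℝ≥0) M.k) (fun _ _ => min_le_left _ _)
      (fun i j hj => by
        rw [if_neg hj.ne']; exact add_tsub_cancel_of_le (min_le_right _ _))
      (fun _ => rfl) (fun _ => if_pos rfl)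
    refine ⟨π, hπ, fun π' => ?_⟩
    have : m ≤ meanResponseTime M π' := iInf_le _ π'
    rw [hm0, top_le_iff] at this
    rw [this]
    exact le_top
  set L : ℝ≥0∞ := ((M.lamI + M.lamE : ℝ≥0) : ℝ≥0∞) with hL
  have hLt : L ≠ ∞ := ENNReal.coe_ne_top
  have hL0 : L ≠ 0 := by
    rw [hL]; exact_mod_cast (add_pos M.lamI_pos M.lamE_pos).ne'
  have hseq : ∀ n : ℕ, ∃ a u v : ℕ × ℕ → ℝ≥0∞, IsAllocation M.k a u v ∧ ∑' s, a s = 1 ∧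
      ∑' s, a s * ((s.1 + s.2 : ℕ) : ℝ≥0∞) ≤ L * (m + ((n + 1 : ℕ) : ℝ≥0∞)⁻¹) ∧
      ∀ s, inflow M a u v s ≤ outflow M a u v s + ((n + 1 : ℕ) : ℝ≥0∞)⁻¹ * uniformRate M ∧
        outflow M a u v s ≤ inflow M a u v s + ((n + 1 : ℕ) : ℝ≥0∞)⁻¹ * uniformRate M := by
    intro n
    have hlt : m < m + ((n + 1 : ℕ) : ℝ≥0∞)⁻¹ :=
      ENNReal.lt_add_right hm0 (ENNReal.inv_ne_zero.2 (ENNReal.natCast_ne_top _))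
    obtain ⟨π, hπ⟩ := iInf_lt_iff.1 (hm ▸ hlt)
    unfold meanResponseTime at hπ
    obtain ⟨ν, hπ⟩ := iInf_lt_iff.1 hπ
    obtain ⟨hν, hπ⟩ := iInf_lt_iff.1 hπ
    obtain ⟨a, u, v, h, h1, hC, hb⟩ := exists_isAllocation_nearly_balanced hν n.succ_ne_zero
    exact ⟨a, u, v, h, h1, hC.trans (mul_le_mul_right hπ.le _), hb⟩
  choose a u v h h1 hC hb using hseq
  have hinv : Tendsto (fun n : ℕ => ((n + 1 : ℕ) : ℝ≥0∞)⁻¹) atTop (𝓝 0) :=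
    ENNReal.tendsto_inv_nat_nhds_zero.comp (tendsto_add_atTop_nat 1)
  have hCl : Tendsto (fun n : ℕ => L * (m + ((n + 1 : ℕ) : ℝ≥0∞)⁻¹)) atTop (𝓝 (L * m)) := by
    have := ENNReal.Tendsto.const_mul (tendsto_const_nhds (x := m) |>.add hinv) (Or.inr hLt)
    rwa [add_zero] at this
  have hδl : Tendsto (fun n : ℕ => ((n + 1 : ℕ) : ℝ≥0∞)⁻¹ * uniformRate M) atTop (𝓝 0) := by
    have := ENNReal.Tendsto.mul_const (b := (uniformRate M : ℝ≥0∞)) hinv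
      (Or.inr ENNReal.coe_ne_top)
    rwa [zero_mul] at this
  obtain ⟨a', u', v', h', h1', hC', hb'⟩ := exists_balanced_isAllocation M
    (ENNReal.mul_ne_top hLt hm0) h h1 hC hCl hδl (fun n s => (hb n s).1) (fun n s => (hb n s).2)
  obtain ⟨π, ν, hπ, hν, hνa⟩ := exists_workConserving_isStationary M h' h1' hb'
  refine ⟨π, hπ, fun π' => le_trans ?_ (iInf_le _ π' : m ≤ _)⟩
  refine (iInf₂_le ν hν).trans ?_
  refine (ENNReal.mul_le_mul_iff_right hL0 hLt).1 ?_
  refine (lam_mul_lintegral_responseTime_le hν).trans ?_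
  simpa only [hνa] using hC'

end ElasticQueue

theorem mainTheorem6 (M : ElasticQueue.Model) (hload : M.load < 1) :
    (∀ π : ElasticQueue.Policy M.k, π.IdlesUnnecessarily →
      ∃ π' : ElasticQueue.Policy M.k, ¬ π'.IdlesUnnecessarily ∧
        ElasticQueue.meanResponseTime M π' ≤ ElasticQueue.meanResponseTime M π) ∧
    (∃ πopt : ElasticQueue.Policy M.k, πopt.WorkConserving ∧
      ∀ π : ElasticQueue.Policy M.k,
        ElasticQueue.meanResponseTime M πopt ≤ ElasticQueue.meanResponseTime M π) := by
  obtain ⟨πopt, hwc, hopt⟩ := ElasticQueue.exists_workConserving_forall_le M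
  exact ⟨fun π _ => ⟨πopt, (πopt.workConserving_iff).1 hwc, hopt π⟩, πopt, hwc, hopt⟩
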